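/- Let $N\in\mathbb N$, $\Omega=(0,1)^N$, and let $|\cdot|$ denote the Euclidean norm on $\mathbb R^N$. For $u=(u^1,\dots,u^N)\in L^1(\Omega;\mathbb R^N)$ put $E_{ij}u=\frac12(D_iu^j+D_ju^i)$ in the sense of distributions on $\Omega$, and let $BD(\Omega)$ be the set of all $u\in L^1(\Omega;\mathbb R^N)$ such that every $E_{ij}u$, $1\le i,j\le N$, is a bounded signed measure on $\Omega$. For $u\in BD(\Omega)$ write $$\int_\Omega|Eu|:=\sum_{i,j=1}^N\int_\Omega|E_{ij}u|,$$ where $\int_\Omega|E_{ij}u|$ is the total variation of the measure $E_{ij}u$ on $\Omega$, and for $u,v\in BD(\Omega)$ put $$d(u,v)=\|u-v\|_{L^1(\Omega;\mathbb R^N)}+\Big|\int_\Omega|Eu|-\int_\Omega|Ev|\Big|.$$ Let $(m_n)$ be a sequence of positive integers such that $h_n:=1/m_n\to0$ (for instance $m_n=n$). Let $\Delta(x)=\prod_{i=1}^N\max(0,1-|x^i|)$ for $x\in\mathbb R^N$, and let $$X_n=\Big\{\sum_{\alpha\in\{0,\dots,m_n\}^N}\sum_{k=1}^N c_\alpha^k\,\Delta\Big(\frac{\cdot-h_n\alpha}{h_n}\Big)e_k\;:\;c_\alpha^k\in\mathbb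 R\Big\}$$ be the space of $\mathbb R^N$-valued continuous piecewise multilinear splines on the uniform grid of mesh size $h_n$, where $e_1,\dots,e_N$ is the standard basis of $\mathbb R^N$. Then for every $1\le r<\infty$ and every $u\in BD(\Omega)\cap L^r(\Omega;\mathbb R^N)$ there is a sequence $(u_n)$ with $u_n\in X_n$ and $u_n\in BD(\Omega)\cap L^r(\Omega;\mathbb R^N)$ for every $n$, such that $$\lim_{n\to\infty}\int_\Omega|u-u_n|^r\,dx=0,\qquad \lim_{n\to\infty}\int_\Omega|Eu_n|=\int_\Omega|Eu|,\qquad \lim_{n\to\infty}d(u_n,u)=0.$$ -/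

import Mathlib

open MeasureTheory Filter Topology
open scoped ContDiff

noncomputable section

namespace BDSpline

/-- `ℝ^N` with its Euclidean norm. -/
abbrev Space (N : ℕ) : Type := EuclideanSpace ℝ (Fin N)

/-- The standard basis vector `e_i` of `ℝ^N`. -/
def basisVec {N : ℕ} (i : Fin N) : Space N := EuclideanSpace.single i 1

/-- The open unit cube `Ω = (0,1)^N`. -/
def cube (N : ℕ) : Set (Space N) := {x | ∀ i, x i ∈ Set.Ioo (0 : ℝ) 1}

/-- `φ ∈ C_c^∞(Ω)`: real test functions on the open cube. -/
def IsTestFunction {N : ℕ} (φ : Space N → ℝ) : Prop :=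
  ContDiff ℝ ∞ φ ∧ HasCompactSupport φ ∧ tsupport φ ⊆ cube N

/-- The classical partial derivative `∂_i φ`. -/
def partialDeriv {N : ℕ} (i : Fin N) (φ : Space N → ℝ) (x : Space N) : ℝ :=
  fderiv ℝ φ x (basisVec i)

/-- `μ` is a bounded signed Borel measure on `Ω` (realised on `ℝ^N` as a measure carried by `Ω`)
that represents the distribution `E_ij u = (D_i u^j + D_j u^i) / 2` on `Ω`. -/
def IsSymDeriv {N : ℕ} (u : Space N → Space N) (i j : Fin N) (μ : SignedMeasure (Space N)) :
    Prop :=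
  μ.totalVariation (cube N)ᶜ = 0 ∧
    ∀ φ : Space N → ℝ, IsTestFunction φ →
      ∫ᵛ x, φ x ∂<•μ =
        - ∫ x in cube N, (1 / 2 : ℝ) * (u x j * partialDeriv i φ x + u x i * partialDeriv j φ x)

/-- `u ∈ BD(Ω)`: `u ∈ L¹(Ω; ℝ^N)` and every `E_ij u` is a bounded measure on `Ω`. -/
def IsBD {N : ℕ} (u : Space N → Space N) : Prop :=
  IntegrableOn u (cube N) ∧ ∀ i j, ∃ μ : SignedMeasure (Space N), IsSymDeriv u i j μ

theorem measurableSet_cube (N : ℕ) : MeasurableSet (cube N) := by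
  have : cube N = ⋂ i, {x : Space N | x i ∈ Set.Ioo (0 : ℝ) 1} := by
    ext x; simp [cube]
  rw [this]
  exact MeasurableSet.iInter fun i =>
    measurableSet_Ioo.preimage (by fun_prop : Measurable fun x : Space N => x i)

theorem isBounded_cube (N : ℕ) : Bornology.IsBounded (cube N) := by
  refine isBounded_iff_forall_norm_le.2 ⟨Real.sqrt N, fun x hx => ?_⟩
  rw [EuclideanSpace.norm_eq]
  apply Real.sqrt_le_sqrt
  calc ∑ i, ‖x i‖ ^ 2 ≤ ∑ _i : Fin N, (1 : ℝ) := by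
        refine Finset.sum_le_sum fun i _ => ?_
        have := hx i
        rw [Real.norm_eq_abs, sq_abs]
        nlinarith [this.1, this.2]
    _ = N := by simp

theorem apply_eq_zero_of_subset_compl {N : ℕ} {μ : SignedMeasure (Space N)}
    (h : μ.totalVariation (cube N)ᶜ = 0) {A : Set (Space N)} (hA : A ⊆ (cube N)ᶜ) : μ A = 0 :=
  μ.null_of_totalVariation_zero (measure_mono_null hA h)

/-- The representing measure is unique. -/
theorem IsSymDeriv.unique {N : ℕ} {u : Space N → Space N} {i j : Fin N}
    {μ ν : SignedMeasure (Space N)} (hμ : IsSymDeriv u i j μ) (hν : IsSymDeriv u i j ν) :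
    μ = ν := by
  have hfin : ∀ σ : SignedMeasure (Space N), IsFiniteMeasure σ.variation := fun σ => by
    rw [← SignedMeasure.totalVariation_eq_variation]; infer_instance
  have hcube : ∀ U : Set (Space N), IsOpen U → U ⊆ cube N → μ U = ν U := by
    intro U hU hUc
    obtain ⟨f, hfs, hfd, hfr⟩ := hU.exists_contDiff_support_eq (n := ⊤)
    have hf0 : ∀ x, 0 ≤ f x := fun x => (hfr ⟨x, rfl⟩).1
    set g : ℕ → Space N → ℝ := fun n x => Real.smoothTransition (n * f x - 1) with hg
    have hgd : ∀ n, ContDiff ℝ ∞ (g n) := fun n =>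
      Real.smoothTransition.contDiff.comp ((contDiff_const.mul hfd).sub contDiff_const)
    have hts : ∀ n, tsupport (g n) ⊆ U := by
      intro n
      have hcl : IsClosed {x | 1 ≤ n * f x} :=
        isClosed_le continuous_const (continuous_const.mul hfd.continuous)
      have h1 : Function.support (g n) ⊆ {x | 1 ≤ n * f x} := by
        intro x hx
        by_contra hcon
        simp only [Set.mem_ofPred_eq, not_le] at hcon
        exact hx (Real.smoothTransition.zero_of_nonpos (by linarith))
      refine (closure_minimal h1 hcl).trans fun x hx => ?_
      rw [← hfs]
      intro h0
      have : (1 : ℝ) ≤ n * f x := hx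
      rw [h0] at this
      norm_num at this
    have htest : ∀ n, IsTestFunction (g n) := fun n =>
      ⟨hgd n, Metric.isCompact_of_isClosed_isBounded (isClosed_tsupport _)
        ((isBounded_cube N).subset ((hts n).trans hUc)), (hts n).trans hUc⟩
    have hlim : ∀ x, Tendsto (fun n => g n x) atTop (𝓝 (U.indicator (fun _ => (1 : ℝ)) x)) := by
      intro x
      by_cases hx : x ∈ U
      · rw [Set.indicator_of_mem hx]
        have hpos : 0 < f x := lt_of_le_of_ne (hf0 x) (Ne.symm (by rw [← hfs] at hx; exact hx))
        refine tendsto_const_nhds.congr' ?_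
        obtain ⟨k, hk⟩ := exists_nat_gt (2 / f x)
        filter_upwards [eventually_ge_atTop k] with n hn
        have hkn : (k : ℝ) ≤ n := by exact_mod_cast hn
        have : 2 < n * f x := by
          rw [div_lt_iff₀ hpos] at hk
          nlinarith
        exact (Real.smoothTransition.one_of_one_le (by linarith)).symm
      · rw [Set.indicator_of_notMem hx]
        refine tendsto_const_nhds.congr fun n => ?_
        have : f x = 0 := by
          rw [← hfs] at hx; simpa using hx
        simp [hg, this, Real.smoothTransition.zero_of_nonpos]
    have hconv : ∀ σ : SignedMeasure (Space N),
        Tendsto (fun n => ∫ᵛ x, g n x ∂<•σ) atTop (𝓝 (σ U)) := by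
      intro σ
      have := hfin σ
      have h1 : ∫ᵛ x, U.indicator (fun _ => (1 : ℝ)) x ∂<•σ = σ U := by
        rw [VectorMeasure.integral_indicator_const _ hU.measurableSet]
        simp
      rw [← h1]
      refine VectorMeasure.tendsto_integral_of_dominated_convergence (fun _ => (1 : ℝ))
        (fun n => (hgd n).continuous.aestronglyMeasurable) (integrable_const _)
        (fun n => ae_of_all _ fun x => ?_) (ae_of_all _ hlim)
      rw [Real.norm_eq_abs, abs_of_nonneg (Real.smoothTransition.nonneg _)]
      exact Real.smoothTransition.le_one _
    refine tendsto_nhds_unique (hconv μ) ((hconv ν).congr fun n => ?_)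
    rw [hμ.2 _ (htest n), hν.2 _ (htest n)]
  have hcubeOpen : IsOpen (cube N) := by
    have : cube N = ⋂ i, {x : Space N | x i ∈ Set.Ioo (0 : ℝ) 1} := by
      ext x; simp [cube]
    rw [this]
    exact isOpen_iInter_of_finite fun i =>
      isOpen_Ioo.preimage (by fun_prop : Continuous fun x : Space N => x i)
  have hopen : ∀ U : Set (Space N), IsOpen U → μ U = ν U := by
    intro U hU
    have hdec : ∀ σ : SignedMeasure (Space N), σ.totalVariation (cube N)ᶜ = 0 →
        σ U = σ (U ∩ cube N) := by
      intro σ hσ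
      have h := σ.of_add_of_sdiff (hU.inter hcubeOpen).measurableSet hU.measurableSet
        Set.inter_subset_left
      have h0 : σ (U \ (U ∩ cube N)) = 0 :=
        apply_eq_zero_of_subset_compl hσ fun x hx hc => hx.2 ⟨hx.1, hc⟩
      rw [← h, h0, add_zero]
    rw [hdec μ hμ.1, hdec ν hν.1]
    exact hcube _ (hU.inter hcubeOpen) Set.inter_subset_right
  refine VectorMeasure.ext fun A hA => ?_
  induction A, hA using MeasurableSpace.induction_on_inter
    (BorelSpace.measurable_eq (α := Space N)) isPiSystem_isOpen with
  | empty => simp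
  | basic U hU => exact hopen U hU
  | compl A hA ih =>
    have h1 := μ.of_add_of_sdiff hA MeasurableSet.univ (Set.subset_univ _)
    have h2 := ν.of_add_of_sdiff hA MeasurableSet.univ (Set.subset_univ _)
    have h3 := hopen Set.univ isOpen_univ
    rw [Set.compl_eq_univ_sdiff]
    linarith
  | iUnion A hd hA ih =>
    rw [μ.of_disjoint_iUnion hA hd, ν.of_disjoint_iUnion hA hd]
    exact tsum_congr ih

open Classical in
/-- The measure `E_ij u` for `u ∈ BD(Ω)` (unique by `IsSymDeriv.unique`). -/
def symDeriv {N : ℕ} (u : Space N → Space N) (i j : Fin N) : SignedMeasure (Space N) :=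
  if h : ∃ μ : SignedMeasure (Space N), IsSymDeriv u i j μ then h.choose else 0

theorem IsSymDeriv.symDeriv_eq {N : ℕ} {u : Space N → Space N} {i j : Fin N}
    {μ : SignedMeasure (Space N)} (h : IsSymDeriv u i j μ) : symDeriv u i j = μ := by
  have hex : ∃ μ : SignedMeasure (Space N), IsSymDeriv u i j μ := ⟨μ, h⟩
  rw [symDeriv, dif_pos hex]
  exact hex.choose_spec.unique h

/-- The deformation seminorm `∫_Ω |E u| = ∑_{i,j} ∫_Ω |E_ij u|`, where `∫_Ω |E_ij u|` is the total
variation of the measure `E_ij u` on `Ω`. -/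
def totalDeformation {N : ℕ} (u : Space N → Space N) : ℝ :=
  ∑ i, ∑ j, ((symDeriv u i j).totalVariation (cube N)).toReal

/-- The metric `d(u, v) = ‖u - v‖_{L¹(Ω)} + |∫_Ω |E u| - ∫_Ω |E v||` of strict convergence. -/
def strictDist {N : ℕ} (u v : Space N → Space N) : ℝ :=
  (∫ x in cube N, ‖u x - v x‖) + |totalDeformation u - totalDeformation v|

/-- The mesh size `h = 1 / m` of the uniform grid with `m` cells in each direction. -/
def meshSize (m : ℕ) : ℝ := 1 / m

/-- The hat function `Δ(x) = ∏_i max(0, 1 - |x_i|)`. -/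
def hat {N : ℕ} (x : Space N) : ℝ := ∏ i, max 0 (1 - |x i|)

/-- The grid node `ξ_α = h α`, for a multi-index `α ∈ {0, …, m}^N`. -/
def gridNode {N : ℕ} (m : ℕ) (α : Fin N → Fin (m + 1)) : Space N :=
  WithLp.toLp 2 fun i => meshSize m * ((α i : ℕ) : ℝ)

/-- The space of piecewise multilinear splines on the uniform grid of mesh size `h = 1 / m`: all
`u = ∑_α ∑_k c_α^k Δ((· - ξ_α) / h) e_k` with real coefficients `c_α^k`. -/
def splineSpace (N m : ℕ) : Set (Space N → Space N) :=
  {u | ∃ c : (Fin N → Fin (m + 1)) → Fin N → ℝ, ∀ x,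
    u x = ∑ α, ∑ k, (c α k * hat ((meshSize m)⁻¹ • (x - gridNode m α))) • basisVec k}

end BDSpline

end

open BDSpline

/-!
Strict convergence splits into an upper bound and a lower bound for the total variations of the
measures `E_ij`. The lower bound is automatic: each total variation is a supremum of pairings with
test functions, hence lower semicontinuous for `L¹` convergence
(`IsSymDeriv.eventually_totalVariation_le`). So it suffices to find, on every sufficiently fine
grid, a spline that is `L^r`-close to `u` and whose total variations exceed those of `u` by little
(`eventually_exists_spline_approx`).

Such a spline comes in two steps. First, `u` is replaced by a `C¹` field on the whole space
(`exists_contDiff_approx`): the cube is contracted towards its centre and `u` is mollified on a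
scale below the distance of the contracted cube from the boundary. On the cube the symmetric
derivatives of the new field are mollifications of the measures `E_ij u`
(`symPartial_contractMollify_eq`), so that their `L¹` norms are at most `(1 - 2δ) ^ (-N)` times the
total variations, by Fubini; the `L^r` convergence follows from the uniform `L^r` bound and density
of continuous functions.

Second, the `C¹` field is interpolated at the nodes of the grid. Interpolation reproduces affine
functions, so the increments of the interpolant in a coordinate direction differ from those of the
Taylor polynomial by a sum of remainders of size `o(h)` against increments of hats, which amount to
`O(|t| / h)` in total. Hence the partial derivatives of the interpolants converge uniformly
(`eventually_nodalInterp_close`). Splines are Lipschitz, so their measures `E_ij` have the a.e.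
symmetric derivatives as densities (`isSymDeriv_of_lipschitz`), and the total variations of the
interpolants are controlled.
-/

namespace BDSpline

open scoped ENNReal Convolution

/-! ### Lower semicontinuity of the total variation -/

theorem isOpen_cube (N : ℕ) : IsOpen (cube N) := by
  have : cube N = ⋂ i, {x : Space N | x i ∈ Set.Ioo (0 : ℝ) 1} := by
    ext x; simp [cube]
  rw [this]
  exact isOpen_iInter_of_finite fun i =>
    isOpen_Ioo.preimage (by fun_prop : Continuous fun x : Space N => x i)

theorem enorm_integral_le_lintegral_totalVariation {X : Type*} [MeasurableSpace X]
    (μ : SignedMeasure X) (φ : X → ℝ) :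
    ‖∫ᵛ x, φ x ∂<•μ‖ₑ ≤ ∫⁻ x, ‖φ x‖ₑ ∂μ.totalVariation := by
  rw [SignedMeasure.totalVariation_eq_variation]
  refine (VectorMeasure.enorm_integral_le_lintegral_enorm_transpose).trans ?_
  rw [VectorMeasure.variation_transpose_lsmul_flip]

/-- The total variation of a signed measure carried by the cube is almost attained by pairing it
with test functions of absolute value at most `1`: smooth functions that are `1` on a large compact
part of the positive Hahn set and `-1` on a large compact part of the negative one. -/
theorem exists_testFunction_totalVariation_le {N : ℕ} {μ : SignedMeasure (Space N)}
    (hμ : μ.totalVariation (cube N)ᶜ = 0) {η : ℝ} (hη : 0 < η) :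
    ∃ φ : Space N → ℝ, IsTestFunction φ ∧ (∀ x, |φ x| ≤ 1) ∧
      (μ.totalVariation (cube N)).toReal ≤ ∫ᵛ x, φ x ∂<•μ + η := by
  obtain ⟨P, hP, hpos, hneg, hposPart, hnegPart⟩ := μ.toJordanDecomposition_spec
  have hfin : IsFiniteMeasure μ.variation := by
    rw [← SignedMeasure.totalVariation_eq_variation]; infer_instance
  have hΩ := measurableSet_cube N
  have hη2 : ENNReal.ofReal (η / 4) ≠ 0 := by simpa using hη
  -- Compact subsets exhausting the Hahn sets inside the cube up to small `|μ|`-measure.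
  obtain ⟨K, hKP, hK, hKm⟩ := (hP.inter hΩ).exists_isCompact_sdiff_lt
    (μ := μ.totalVariation) (measure_ne_top _ _) hη2
  obtain ⟨J, hJP, hJ, hJm⟩ := (hP.compl.inter hΩ).exists_isCompact_sdiff_lt
    (μ := μ.totalVariation) (measure_ne_top _ _) hη2
  have hKJ : Disjoint K J := Set.disjoint_left.2 fun x hx hy => (hJP hy).1 (hKP hx).1
  have hcut : ∀ A B : Set (Space N), IsCompact A → IsCompact B → A ⊆ cube N → Disjoint A B →
      ∃ f : Space N → ℝ, IsTestFunction f ∧ (∀ x ∈ A, f x = 1) ∧ (∀ x ∈ B, f x = 0) ∧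
        ∀ x, 0 ≤ f x ∧ f x ≤ 1 := by
    intro A B hA hB hAc hAB
    obtain ⟨f, h0, h1, hf⟩ := exists_contMDiffMap_zero_one_nhds_of_isClosed (n := ⊤)
      (modelWithCornersSelf ℝ (Space N)) (s := (cube N)ᶜ ∪ B) (t := A)
      ((isOpen_cube N).isClosed_compl.union hB.isClosed) hA.isClosed
      (Set.disjoint_left.2 fun x hx hxA =>
        hx.elim (fun h => h (hAc hxA)) (Set.disjoint_left.1 hAB hxA))
    have hsupp : tsupport f ⊆ cube N := by
      intro x hx
      by_contra hxc
      refine notMem_tsupport_iff_eventuallyEq.2 ?_ hx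
      exact (eventually_nhdsSet_iff_forall.1 h0) x (Or.inl hxc)
    refine ⟨f, ⟨f.contMDiff.contDiff, Metric.isCompact_of_isClosed_isBounded (isClosed_tsupport _)
        ((isBounded_cube N).subset hsupp), hsupp⟩,
      fun x hx => h1.self_of_nhdsSet x hx, fun x hx => h0.self_of_nhdsSet x (Or.inr hx),
      fun x => hf x⟩
  obtain ⟨f, hf, hf1, hf0, hf01⟩ := hcut K J hK hJ (fun x hx => (hKP hx).2) hKJ
  obtain ⟨g, hg, hg1, hg0, hg01⟩ := hcut J K hJ hK (fun x hx => (hJP hx).2) hKJ.symm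
  have htest : IsTestFunction (f - g) :=
    ⟨hf.1.sub hg.1, hf.2.1.sub hg.2.1,
      (tsupport_sub f g).trans (Set.union_subset hf.2.2 hg.2.2)⟩
  have habs : ∀ x, |(f - g) x| ≤ 1 := fun x => by
    rw [Pi.sub_apply, abs_le]
    constructor <;> linarith [(hf01 x).1, (hf01 x).2, (hg01 x).1, (hg01 x).2]
  refine ⟨f - g, htest, habs, ?_⟩
  set sgn : Space N → ℝ := fun x => P.indicator (fun _ => (1 : ℝ)) x - Pᶜ.indicator (fun _ => 1) x
    with hsgn
  have hi1 : μ.Integrable (P.indicator (fun _ => (1 : ℝ))) :=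
    (integrable_const (1 : ℝ)).indicator hP
  have hi2 : μ.Integrable (Pᶜ.indicator (fun _ => (1 : ℝ))) :=
    (integrable_const (1 : ℝ)).indicator hP.compl
  have hi3 : μ.Integrable (f - g) :=
    Integrable.of_bound htest.1.continuous.aestronglyMeasurable 1 (ae_of_all _ habs)
  have hsgnint : ∫ᵛ x, sgn x ∂<•μ = μ P - μ Pᶜ := by
    rw [hsgn, VectorMeasure.integral_fun_sub hi1 hi2,
      VectorMeasure.integral_indicator_const _ hP,
      VectorMeasure.integral_indicator_const _ hP.compl]
    simp
  have hTV : (μ.totalVariation (cube N)).toReal ≤ μ P - μ Pᶜ := by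
    refine (ENNReal.toReal_mono (measure_ne_top _ _) (measure_mono (Set.subset_univ _))).trans ?_
    have h1 : 0 ≤ μ P := VectorMeasure.nonneg_of_zero_le_restrict _ hpos
    have h2 : μ Pᶜ ≤ 0 := VectorMeasure.nonpos_of_restrict_le_zero _ hneg
    rw [SignedMeasure.totalVariation, Measure.add_apply, hposPart, hnegPart,
      SignedMeasure.toMeasureOfZeroLE_apply _ hpos hP MeasurableSet.univ,
      SignedMeasure.toMeasureOfLEZero_apply _ hneg hP.compl MeasurableSet.univ]
    rw [ENNReal.toReal_add ENNReal.coe_ne_top ENNReal.coe_ne_top,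
      ENNReal.coe_toReal, ENNReal.coe_toReal, NNReal.coe_mk, NNReal.coe_mk, Set.inter_univ,
      Set.inter_univ]
    exact (sub_eq_add_neg _ _).ge
  -- `f - g` differs from the sign of `μ` only off `K ∪ J`, and there by at most `2`.
  have hbad : ∫⁻ x, ‖sgn x - (f - g) x‖ₑ ∂μ.totalVariation ≤ ENNReal.ofReal η := by
    have hle : ∀ᵐ x ∂μ.totalVariation, ‖sgn x - (f - g) x‖ₑ ≤
        ((P ∩ cube N) \ K).indicator (fun _ => (2 : ℝ≥0∞)) x +
        ((Pᶜ ∩ cube N) \ J).indicator (fun _ => (2 : ℝ≥0∞)) x := by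
      have hae : ∀ᵐ x ∂μ.totalVariation, x ∈ cube N := by
        rw [ae_iff]; exact hμ
      filter_upwards [hae] with x hx
      have h2 : ‖sgn x - (f - g) x‖ₑ ≤ 2 := by
        rw [← ofReal_norm, ← ENNReal.ofReal_ofNat 2]
        apply ENNReal.ofReal_le_ofReal
        have := habs x
        have hs : |sgn x| ≤ 1 := by
          by_cases hxP : x ∈ P <;> simp [hsgn, hxP]
        calc ‖sgn x - (f - g) x‖ ≤ ‖sgn x‖ + ‖(f - g) x‖ := norm_sub_le _ _
          _ ≤ 2 := by simp only [Real.norm_eq_abs]; linarith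
      by_cases hxP : x ∈ P
      · by_cases hxK : x ∈ K
        · have : sgn x - (f - g) x = 0 := by
            simp [hsgn, hxP, hf1 x hxK, hg0 x hxK]
          rw [this, enorm_zero]; exact zero_le
        · rw [Set.indicator_of_mem (s := (P ∩ cube N) \ K) ⟨⟨hxP, hx⟩, hxK⟩]
          exact h2.trans le_self_add
      · by_cases hxJ : x ∈ J
        · have : sgn x - (f - g) x = 0 := by
            simp [hsgn, hxP, hf0 x hxJ, hg1 x hxJ]
          rw [this, enorm_zero]; exact zero_le
        · rw [Set.indicator_of_mem (s := (Pᶜ ∩ cube N) \ J) ⟨⟨hxP, hx⟩, hxJ⟩]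
          exact h2.trans le_add_self
    have hmK : MeasurableSet ((P ∩ cube N) \ K) := 
      MeasurableSet.diff (hP.inter hΩ) hK.measurableSet
    have hmJ : MeasurableSet ((Pᶜ ∩ cube N) \ J) := 
      MeasurableSet.diff (hP.compl.inter hΩ) hJ.measurableSet
    refine (lintegral_mono_ae hle).trans ?_
    rw [lintegral_add_left (measurable_const.indicator hmK), lintegral_indicator_const hmK,
      lintegral_indicator_const hmJ]
    calc _ ≤ 2 * ENNReal.ofReal (η / 4) + 2 * ENNReal.ofReal (η / 4) := by gcongr
      _ = ENNReal.ofReal η := by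
        rw [← ENNReal.ofReal_ofNat 2, ← ENNReal.ofReal_mul (by norm_num),
          ← ENNReal.ofReal_add (by positivity) (by positivity)]
        congr 1; ring
  have hdiff : |∫ᵛ x, sgn x ∂<•μ - ∫ᵛ x, (f - g) x ∂<•μ| ≤ η := by
    have hi4 : μ.Integrable sgn := hi1.sub hi2
    rw [← VectorMeasure.integral_fun_sub hi4 hi3]
    have := (enorm_integral_le_lintegral_totalVariation μ
      (fun x => sgn x - (f - g) x)).trans hbad
    rw [← ofReal_norm, ENNReal.ofReal_le_ofReal_iff hη.le] at this
    exact this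
  rw [hsgnint] at hdiff
  linarith [(abs_le.1 hdiff).2]

/-- The total variation of each `E_ij` is lower semicontinuous under `L¹` convergence of the
fields. -/
theorem IsSymDeriv.eventually_totalVariation_le {N : ℕ} {u : Space N → Space N}
    {v : ℕ → Space N → Space N} {i j : Fin N} {μ : SignedMeasure (Space N)}
    {ν : ℕ → SignedMeasure (Space N)} (hμ : IsSymDeriv u i j μ)
    (hν : ∀ n, IsSymDeriv (v n) i j (ν n)) (hu : IntegrableOn u (cube N))
    (hv : ∀ n, IntegrableOn (v n) (cube N))
    (hlim : Tendsto (fun n => ∫ x in cube N, ‖v n x - u x‖) atTop (𝓝 0)) {η : ℝ} (hη : 0 < η) :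
    ∀ᶠ n in atTop, (μ.totalVariation (cube N)).toReal ≤
      ((ν n).totalVariation (cube N)).toReal + η := by
  obtain ⟨φ, hφ, hφ1, hφμ⟩ := exists_testFunction_totalVariation_le hμ.1 (half_pos hη)
  have hpd : ∀ i : Fin N, ∃ C : ℝ, ∀ x, |partialDeriv i φ x| ≤ C := fun i => by
    have hc : Continuous (partialDeriv i φ) :=
      (hφ.1.continuous_fderiv (by simp)).clm_apply continuous_const
    have hs : HasCompactSupport (partialDeriv i φ) :=
      hφ.2.1.fderiv_apply (𝕜 := ℝ) (basisVec i)
    exact hs.exists_bound_of_continuous hc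
  obtain ⟨C, hC⟩ := hpd i
  obtain ⟨D, hD⟩ := hpd j
  have hpm : ∀ i : Fin N, AEStronglyMeasurable (partialDeriv i φ) (volume.restrict (cube N)) :=
    fun i => ((hφ.1.continuous_fderiv (by simp)).clm_apply
      continuous_const).aestronglyMeasurable
  have hint : ∀ w : Space N → Space N, IntegrableOn w (cube N) →
      IntegrableOn (fun x => (1 / 2 : ℝ) *
        (w x j * partialDeriv i φ x + w x i * partialDeriv j φ x))
        (cube N) := by
    intro w hw
    have hcomp : ∀ k : Fin N, IntegrableOn (fun x => w x k) (cube N) := fun k =>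
      (EuclideanSpace.proj k : Space N →L[ℝ] ℝ).integrable_comp hw
    refine (Integrable.add ?_ ?_).const_mul _
    · exact (hcomp j).mul_bdd (hpm i) (ae_of_all _ hC)
    · exact (hcomp i).mul_bdd (hpm j) (ae_of_all _ hD)
  have hclose : ∀ n, |∫ᵛ x, φ x ∂<•μ - ∫ᵛ x, φ x ∂<•(ν n)| ≤
      (C + D) / 2 * ∫ x in cube N, ‖v n x - u x‖ := by
    intro n
    rw [hμ.2 φ hφ, (hν n).2 φ hφ, neg_sub_neg, ← integral_sub (hint _ (hv n)) (hint _ hu),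
      ← integral_const_mul]
    rw [← Real.norm_eq_abs]
    refine norm_integral_le_of_norm_le (g := fun x => (C + D) / 2 * ‖v n x - u x‖)
      (((hv n).sub hu).norm.const_mul _) (ae_of_all _ fun x => ?_)
    have hk : ∀ k : Fin N, |v n x k - u x k| ≤ ‖v n x - u x‖ := fun k =>
      PiLp.norm_apply_le (v n x - u x) k
    have h1 : |(v n x j - u x j) * partialDeriv i φ x| ≤ ‖v n x - u x‖ * C := by
      rw [abs_mul]; exact mul_le_mul (hk j) (hC x) (abs_nonneg _) (norm_nonneg _)
    have h2 : |(v n x i - u x i) * partialDeriv j φ x| ≤ ‖v n x - u x‖ * D := by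
      rw [abs_mul]; exact mul_le_mul (hk i) (hD x) (abs_nonneg _) (norm_nonneg _)
    rw [Real.norm_eq_abs, abs_le]
    rw [abs_le] at h1 h2
    constructor <;> linarith [h1.1, h1.2, h2.1, h2.2]
  have hTVν : ∀ n, ∫ᵛ x, φ x ∂<•(ν n) ≤ ((ν n).totalVariation (cube N)).toReal := by
    intro n
    have h1 : ‖∫ᵛ x, φ x ∂<•(ν n)‖ₑ ≤ (ν n).totalVariation (cube N) := by
      refine (enorm_integral_le_lintegral_totalVariation _ _).trans ?_
      calc ∫⁻ x, ‖φ x‖ₑ ∂(ν n).totalVariation ≤ ∫⁻ _, 1 ∂(ν n).totalVariation := by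
            refine lintegral_mono fun x => ?_
            rw [← ofReal_norm, ← ENNReal.ofReal_one]
            exact ENNReal.ofReal_le_ofReal (hφ1 x)
        _ = (ν n).totalVariation (cube N) := by
            rw [lintegral_one, ← measure_add_measure_compl (measurableSet_cube N), (hν n).1,
              add_zero]
    rw [← ofReal_norm, ENNReal.ofReal_le_iff_le_toReal (measure_ne_top _ _)] at h1
    exact (le_abs_self _).trans h1
  have hlim' := (hlim.const_mul ((C + D) / 2)).eventually_lt_const
    (show (C + D) / 2 * 0 < η / 2 by simpa using hη)
  filter_upwards [hlim'] with n hn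
  have := (abs_le.1 (hclose n)).2
  linarith [hTVν n]

/-! ### Symmetric derivatives of Lipschitz fields -/

/-- Integration of a bounded function against the signed measure with density `g`. -/
theorem integral_withDensityᵥ {X : Type*} [MeasurableSpace X] {μ : Measure X} {g φ : X → ℝ}
    (hg : Integrable g μ) (hφ : StronglyMeasurable φ) {C : ℝ} (hC : ∀ x, |φ x| ≤ C) :
    ∫ᵛ x, φ x ∂<•(μ.withDensityᵥ g) = ∫ x, φ x * g x ∂μ := by
  have h1 := isFiniteMeasure_withDensity_ofReal hg.2
  have h2 := isFiniteMeasure_withDensity_ofReal hg.neg.2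
  have hm := hg.aestronglyMeasurable.aemeasurable
  have hi : ∀ ν : Measure X, IsFiniteMeasure ν → Integrable φ ν := fun ν _ =>
    Integrable.of_bound hφ.aestronglyMeasurable C (ae_of_all _ hC)
  have hpos : Integrable (fun x => max (g x) 0 * φ x) μ :=
    hg.pos_part.mul_bdd hφ.aestronglyMeasurable (ae_of_all _ hC)
  have hneg : Integrable (fun x => max (-g x) 0 * φ x) μ :=
    hg.neg_part.mul_bdd hφ.aestronglyMeasurable (ae_of_all _ hC)
  rw [withDensityᵥ_eq_withDensity_pos_part_sub_withDensity_neg_part hg,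
    VectorMeasure.integral_sub_vectorMeasure
      (by rw [VectorMeasure.Integrable, Measure.variation_toSignedMeasure]; exact hi _ h1)
      (by rw [VectorMeasure.Integrable, Measure.variation_toSignedMeasure]; exact hi _ h2),
    VectorMeasure.integral_toSignedMeasure, VectorMeasure.integral_toSignedMeasure,
    integral_withDensity_eq_integral_toReal_smul₀ hm.ennreal_ofReal (by simp),
    integral_withDensity_eq_integral_toReal_smul₀ (f := fun x => ENNReal.ofReal (-g x))
      hm.neg.ennreal_ofReal (by simp)]
  simp only [ENNReal.toReal_ofReal', smul_eq_mul]
  rw [← integral_sub hpos hneg]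
  congr 1 with x
  rw [← sub_mul, max_comm, max_comm (-g x)]
  have : max 0 (g x) - max 0 (-g x) = g x := by
    rcases le_total 0 (g x) with h | h
    · rw [max_eq_right h, max_eq_left (by linarith)]; ring
    · rw [max_eq_left h, max_eq_right (by linarith)]; ring
  rw [this, mul_comm]

/-- The pointwise symmetric derivative `(∂_i v^j + ∂_j v^i) / 2`, formed with line derivatives.
Where a line derivative fails to exist it takes the value `0`; for Lipschitz fields this is a null
set. -/
noncomputable def symDensity {N : ℕ} (v : Space N → Space N) (i j : Fin N) (x : Space N) : ℝ :=
  (1 / 2 : ℝ) * (lineDeriv ℝ (fun y => v y j) x (basisVec i) +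
    lineDeriv ℝ (fun y => v y i) x (basisVec j))

theorem volume_cube_lt_top (N : ℕ) : volume (cube N) < ⊤ :=
  (isBounded_cube N).measure_lt_top

theorem integrableOn_lineDeriv_of_lipschitz {N : ℕ} {f : Space N → ℝ} {C : NNReal}
    (hf : LipschitzWith C f) (e : Space N) :
    IntegrableOn (fun x => lineDeriv ℝ f x e) (cube N) := by
  have : IsFiniteMeasure (volume.restrict (cube N)) := ⟨by simpa using volume_cube_lt_top N⟩
  exact ((hf.memLp_lineDeriv (μ := volume) e).restrict (cube N)).integrable le_top

/-- Integration by parts on the cube for a Lipschitz function, without boundary term because the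
test function has compact support in the open cube. -/
theorem setIntegral_lineDeriv_mul {N : ℕ} {f φ : Space N → ℝ} {C : NNReal}
    (hf : LipschitzWith C f) (hφ : IsTestFunction φ) (i : Fin N) :
    ∫ x in cube N, φ x * lineDeriv ℝ f x (basisVec i) =
      - ∫ x in cube N, f x * partialDeriv i φ x := by
  have hs : Function.support φ ⊆ cube N := (subset_tsupport φ).trans hφ.2.2
  have hs' : Function.support (partialDeriv i φ) ⊆ cube N := by
    refine (subset_trans ?_ (tsupport_fderiv_subset ℝ (f := φ))).trans hφ.2.2
    refine subset_trans (fun x hx => ?_) (subset_tsupport _)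
    intro h
    apply hx
    change fderiv ℝ φ x = 0 at h
    rw [partialDeriv, h]; rfl
  obtain ⟨D, hD⟩ := ContDiff.lipschitzWith_of_hasCompactSupport hφ.2.1 hφ.1 (by simp)
  rw [setIntegral_eq_integral_of_forall_compl_eq_zero (fun x hx => ?_),
    setIntegral_eq_integral_of_forall_compl_eq_zero (fun x hx => ?_)]
  · have := hf.integral_lineDeriv_mul_eq (μ := volume) hD hφ.2.1 (basisVec i)
    simp_rw [lineDeriv_neg, ((hφ.1.differentiable (by simp)) _).lineDeriv_eq_fderiv] at this
    calc _ = ∫ x, lineDeriv ℝ f x (basisVec i) * φ x := by simp_rw [mul_comm]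
      _ = _ := by
        rw [this, ← integral_neg]
        congr 1 with x
        rw [partialDeriv]; ring
  · rw [Function.notMem_support.1 fun h => hx (hs' h), mul_zero]
  · rw [Function.notMem_support.1 fun h => hx (hs h), zero_mul]

/-- For a Lipschitz field the measure `E_ij v` has the a.e. symmetric derivative as its density. -/
theorem isSymDeriv_of_lipschitz {N : ℕ} {v : Space N → Space N}
    (hv : ∀ k, ∃ C, LipschitzWith C fun x => v x k) (i j : Fin N) :
    IsSymDeriv v i j ((volume.restrict (cube N)).withDensityᵥ (symDensity v i j)) := by
  obtain ⟨Ci, hi⟩ := hv i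
  obtain ⟨Cj, hj⟩ := hv j
  have hii := integrableOn_lineDeriv_of_lipschitz hi (basisVec j)
  have hjj := integrableOn_lineDeriv_of_lipschitz hj (basisVec i)
  have hint : Integrable (symDensity v i j) (volume.restrict (cube N)) :=
    (hjj.add hii).const_mul _
  refine ⟨?_, fun φ hφ => ?_⟩
  · rw [SignedMeasure.totalVariation_eq_variation, Measure.variation_withDensityᵥ hint,
      withDensity_apply _ (measurableSet_cube N).compl, Measure.restrict_restrict
      (measurableSet_cube N).compl, Set.compl_inter_self, Measure.restrict_empty,
      lintegral_zero_measure]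
  · obtain ⟨M, hM⟩ := hφ.2.1.exists_bound_of_continuous hφ.1.continuous
    rw [integral_withDensityᵥ hint hφ.1.continuous.stronglyMeasurable hM]
    have hbd : ∀ {g : Space N → ℝ}, IntegrableOn g (cube N) →
        IntegrableOn (fun x => φ x * g x) (cube N) := fun hg =>
      Integrable.bdd_mul hg hφ.1.continuous.aestronglyMeasurable (ae_of_all _ hM)
    have hpd : ∀ (k l : Fin N), IntegrableOn (fun x => v x k * partialDeriv l φ x) (cube N) := by
      intro k l
      obtain ⟨C, hC⟩ := hv k
      have hc : Continuous (partialDeriv l φ) :=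
        (hφ.1.continuous_fderiv (by simp)).clm_apply continuous_const
      have hs : HasCompactSupport (partialDeriv l φ) :=
        hφ.2.1.fderiv_apply (𝕜 := ℝ) (basisVec l)
      exact ((hC.continuous.mul hc).integrable_of_hasCompactSupport hs.mul_left).integrableOn
    have hL : ∀ x, φ x * symDensity v i j x =
        (1 / 2 : ℝ) * (φ x * lineDeriv ℝ (fun y => v y j) x (basisVec i) +
          φ x * lineDeriv ℝ (fun y => v y i) x (basisVec j)) := fun x => by
      rw [symDensity]; ring
    simp_rw [hL]
    rw [integral_const_mul, integral_const_mul, integral_add (hbd hjj) (hbd hii),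
      integral_add (hpd j i) (hpd i j), setIntegral_lineDeriv_mul hj hφ,
      setIntegral_lineDeriv_mul hi hφ]
    ring

theorem totalVariation_symDeriv_of_lipschitz {N : ℕ} {v : Space N → Space N}
    (hv : ∀ k, ∃ C, LipschitzWith C fun x => v x k) (i j : Fin N) :
    (symDeriv v i j).totalVariation (cube N) = ∫⁻ x in cube N, ‖symDensity v i j x‖ₑ := by
  obtain ⟨Ci, hi⟩ := hv i
  obtain ⟨Cj, hj⟩ := hv j
  have hint : Integrable (symDensity v i j) (volume.restrict (cube N)) :=
    ((integrableOn_lineDeriv_of_lipschitz hj (basisVec i)).add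
      (integrableOn_lineDeriv_of_lipschitz hi (basisVec j))).const_mul _
  rw [(isSymDeriv_of_lipschitz hv i j).symDeriv_eq, SignedMeasure.totalVariation_eq_variation,
    Measure.variation_withDensityᵥ hint, withDensity_apply _ (measurableSet_cube N),
    Measure.restrict_restrict (measurableSet_cube N), Set.inter_self]

theorem isBD_of_lipschitz {N : ℕ} {v : Space N → Space N} (hc : Continuous v)
    (hv : ∀ k, ∃ C, LipschitzWith C fun x => v x k) : IsBD v := by
  refine ⟨?_, fun i j => ⟨_, isSymDeriv_of_lipschitz hv i j⟩⟩
  exact (hc.continuousOn.integrableOn_compact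
    (isBounded_cube N).isCompact_closure).mono_set subset_closure

/-! ### Nodal interpolation by multilinear splines -/

/-- The one-dimensional hat function `max(0, 1 - |t|)`. -/
noncomputable def tent (t : ℝ) : ℝ := max 0 (1 - |t|)

theorem tent_nonneg (t : ℝ) : 0 ≤ tent t := le_max_left _ _

theorem tent_le_one (t : ℝ) : tent t ≤ 1 :=
  max_le zero_le_one (by linarith [abs_nonneg t])

theorem tent_eq_zero {t : ℝ} (h : 1 ≤ |t|) : tent t = 0 := max_eq_left (by linarith)

theorem abs_tent_sub_le (s t : ℝ) : |tent s - tent t| ≤ |s - t| := by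
  refine (abs_max_sub_max_le_max _ _ _ _).trans (max_le (by simp) ?_)
  rw [sub_sub_sub_cancel_left, abs_sub_comm s t]
  exact abs_abs_sub_abs_le_abs_sub t s

/-- On the cell `[b, b + 1]` only the hats centred at `b` and `b + 1` contribute, so the piecewise
linear interpolant is the affine function through its two end values. -/
theorem sum_mul_tent_of_mem_cell (m b : ℕ) (hb : b < m) {s : ℝ} (h1 : (b : ℝ) ≤ s)
    (h2 : s ≤ b + 1) (F : ℕ → ℝ) :
    ∑ a : Fin (m + 1), F a * tent (s - (a : ℕ)) = F b * (b + 1 - s) + F (b + 1) * (s - b) := by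
  rw [Fin.sum_univ_eq_sum_range (fun a => F a * tent (s - (a : ℝ))) (m + 1)]
  have hsub : ({b, b + 1} : Finset ℕ) ⊆ Finset.range (m + 1) := by
    intro a ha
    simp only [Finset.mem_insert, Finset.mem_singleton] at ha
    rw [Finset.mem_range]; omega
  rw [← Finset.sum_subset hsub, Finset.sum_pair (by omega)]
  · congr 2
    · rw [tent, abs_of_nonneg (by linarith), max_eq_right (by linarith)]; ring
    · push_cast
      rw [tent, abs_of_nonpos (by linarith), max_eq_right (by linarith)]; ring
  · intro a _ ha
    simp only [Finset.mem_insert, Finset.mem_singleton, not_or] at ha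
    rw [tent_eq_zero, mul_zero]
    rcases lt_or_gt_of_ne ha.1 with h | h
    · have : (a : ℝ) + 1 ≤ b := by exact_mod_cast h
      rw [abs_of_nonneg (by linarith)]; linarith
    · have : (b : ℝ) + 2 ≤ a := by
        have : b + 2 ≤ a := by omega
        exact_mod_cast this
      rw [abs_of_nonpos (by linarith)]; linarith

theorem exists_cell {m : ℕ} (hm : 1 ≤ m) {s : ℝ} (h0 : 0 ≤ s) (h1 : s ≤ m) :
    ∃ b : ℕ, b < m ∧ (b : ℝ) ≤ s ∧ s ≤ b + 1 := by
  rcases h1.lt_or_eq with h | h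
  · exact ⟨⌊s⌋₊, (Nat.floor_lt h0).2 h, Nat.floor_le h0, (Nat.lt_floor_add_one s).le⟩
  · refine ⟨m - 1, by omega, ?_, ?_⟩ <;> rw [h, Nat.cast_sub hm] <;> simp

theorem sum_tent {m : ℕ} (hm : 1 ≤ m) {s : ℝ} (h0 : 0 ≤ s) (h1 : s ≤ m) :
    ∑ a : Fin (m + 1), tent (s - (a : ℕ)) = 1 := by
  obtain ⟨b, hb, hb1, hb2⟩ := exists_cell hm h0 h1
  have := sum_mul_tent_of_mem_cell m b hb hb1 hb2 fun _ => 1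
  simp only [one_mul] at this
  rw [this]; ring

theorem sum_coord_mul_tent {m : ℕ} (hm : 1 ≤ m) {s : ℝ} (h0 : 0 ≤ s) (h1 : s ≤ m) :
    ∑ a : Fin (m + 1), ((a : ℕ) : ℝ) * tent (s - (a : ℕ)) = s := by
  obtain ⟨b, hb, hb1, hb2⟩ := exists_cell hm h0 h1
  have := sum_mul_tent_of_mem_cell m b hb hb1 hb2 fun a => a
  rw [this]; push_cast; ring

/-- At most four of the hats can change between two points at distance at most `1`, so the constant
does not depend on `m`. -/
theorem sum_abs_tent_sub_le (m : ℕ) {s t : ℝ} (hst : |t - s| ≤ 1) :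
    ∑ a : Fin (m + 1), |tent (t - (a : ℕ)) - tent (s - (a : ℕ))| ≤ 4 * |t - s| := by
  rw [Fin.sum_univ_eq_sum_range (fun a => |tent (t - (a : ℝ)) - tent (s - (a : ℝ))|) (m + 1)]
  -- Off `S` both hats vanish.
  set S : Finset ℕ := (Finset.range (m + 1)).filter fun a => |s - (a : ℝ)| < 2 with hS
  have hcard : S.card ≤ 4 := by
    have : S.card ≤ (Finset.Icc (⌊s⌋ - 1) (⌊s⌋ + 2)).card := by
      refine Finset.card_le_card_of_injOn (fun a : ℕ => (a : ℤ)) (fun a ha => ?_)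
        fun a _ b _ h => Int.ofNat_inj.1 h
      have ha2 := (Finset.mem_filter.1 ha).2
      rw [abs_lt] at ha2
      have hf1 := Int.floor_le s
      have hf2 := Int.lt_floor_add_one s
      simp only [Finset.coe_Icc, Set.mem_Icc]
      constructor
      · have : ((⌊s⌋ - 2 : ℤ) : ℝ) < ((a : ℤ) : ℝ) := by push_cast; linarith
        have := Int.cast_lt.1 this
        omega
      · have : ((a : ℤ) : ℝ) < ((⌊s⌋ + 3 : ℤ) : ℝ) := by push_cast; linarith
        have := Int.cast_lt.1 this
        omega
    refine this.trans ?_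
    rw [Int.card_Icc]; omega
  have hzero : ∑ a ∈ S, |tent (t - (a : ℝ)) - tent (s - (a : ℝ))| =
      ∑ a ∈ Finset.range (m + 1), |tent (t - (a : ℝ)) - tent (s - (a : ℝ))| := by
    refine Finset.sum_subset (Finset.filter_subset _ _) fun a ha haS => ?_
    have h2 : 2 ≤ |s - (a : ℝ)| := by
      by_contra h
      exact haS (Finset.mem_filter.2 ⟨ha, not_le.1 h⟩)
    have h3 : |s - (a : ℝ)| ≤ |t - s| + |t - (a : ℝ)| := by
      rw [abs_sub_comm t s]; exact abs_sub_le s t a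
    rw [tent_eq_zero (by linarith), tent_eq_zero (by linarith), sub_zero, abs_zero]
  rw [← hzero]
  calc _ ≤ ∑ a ∈ S, |t - s| := Finset.sum_le_sum fun a _ => by
        refine (abs_tent_sub_le _ _).trans (le_of_eq ?_)
        congr 1; ring
    _ = S.card * |t - s| := by rw [Finset.sum_const, nsmul_eq_mul]
    _ ≤ 4 * |t - s| := by gcongr; exact_mod_cast hcard

theorem abs_prod_sub_prod_le_sum {ι : Type*} (s : Finset ι) {a b : ι → ℝ}
    (ha : ∀ i, 0 ≤ a i ∧ a i ≤ 1) (hb : ∀ i, 0 ≤ b i ∧ b i ≤ 1) :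
    |∏ i ∈ s, a i - ∏ i ∈ s, b i| ≤ ∑ i ∈ s, |a i - b i| := by
  classical
  induction s using Finset.induction_on with
  | empty => simp
  | insert k s hk ih =>
    rw [Finset.prod_insert hk, Finset.prod_insert hk, Finset.sum_insert hk]
    have h1 : |∏ i ∈ s, b i| ≤ 1 := by
      rw [abs_of_nonneg (Finset.prod_nonneg fun i _ => (hb i).1)]
      exact Finset.prod_le_one (fun i _ => (hb i).1) fun i _ => (hb i).2
    have h2 : |a k| ≤ 1 := by rw [abs_of_nonneg (ha k).1]; exact (ha k).2
    calc |a k * ∏ i ∈ s, a i - b k * ∏ i ∈ s, b i|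
        = |(a k - b k) * ∏ i ∈ s, b i + a k * (∏ i ∈ s, a i - ∏ i ∈ s, b i)| := by
          congr 1; ring
      _ ≤ |a k - b k| * |∏ i ∈ s, b i| + |a k| * |∏ i ∈ s, a i - ∏ i ∈ s, b i| := by
          rw [← abs_mul, ← abs_mul]; exact abs_add_le _ _
      _ ≤ |a k - b k| * 1 + 1 * ∑ i ∈ s, |a i - b i| := by gcongr
      _ = _ := by ring

variable {N : ℕ}

theorem norm_le_sum_abs (x : Space N) : ‖x‖ ≤ ∑ k, |x k| := by
  have h : x = ∑ k, x k • basisVec k := by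
    ext j
    simp [basisVec, Pi.single_apply]
  conv_lhs => rw [h]
  refine (norm_sum_le _ _).trans (Finset.sum_le_sum fun k _ => ?_)
  rw [norm_smul, basisVec, PiLp.norm_single, norm_one, mul_one, Real.norm_eq_abs]

/-- The nodal basis function of the grid with `m` cells in each direction, centred at the node
`ξ_α`. -/
noncomputable def nodalHat (m : ℕ) (α : Fin N → Fin (m + 1)) (x : Space N) : ℝ :=
  hat ((meshSize m)⁻¹ • (x - gridNode m α))

theorem nodalHat_eq_prod {m : ℕ} (hm : 1 ≤ m) (α : Fin N → Fin (m + 1)) (x : Space N) :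
    nodalHat m α x = ∏ k, tent (m * x k - (α k : ℕ)) := by
  have hm0 : (m : ℝ) ≠ 0 := by positivity
  unfold nodalHat hat tent
  refine Finset.prod_congr rfl fun k _ => ?_
  congr 3
  simp only [gridNode, meshSize, PiLp.smul_apply, PiLp.sub_apply, smul_eq_mul]
  field_simp

theorem nodalHat_nonneg (m : ℕ) (α : Fin N → Fin (m + 1)) (x : Space N) : 0 ≤ nodalHat m α x := by
  unfold nodalHat hat
  exact Finset.prod_nonneg fun _ _ => le_max_left _ _

theorem gridNode_apply (m : ℕ) (α : Fin N → Fin (m + 1)) (k : Fin N) :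
    gridNode m α k = ((α k : ℕ) : ℝ) / m := by
  simp [gridNode, meshSize, div_eq_inv_mul]

/-- Sums over multi-indices of products over the coordinates factor into one-dimensional sums; this
carries every identity for one-dimensional hats over to the tensor-product hats. -/
theorem sum_prod_multiIndex {m : ℕ} (F : Fin N → Fin (m + 1) → ℝ) :
    ∑ α : Fin N → Fin (m + 1), ∏ k, F k (α k) = ∏ k, ∑ a, F k a := by
  rw [Finset.prod_univ_sum, Fintype.piFinset_univ]

theorem mul_mem_Icc_of_mem_cube {m : ℕ} {x : Space N} (hx : x ∈ cube N) (k : Fin N) :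
    0 ≤ m * x k ∧ m * x k ≤ m := by
  have := hx k
  constructor
  · exact mul_nonneg (by positivity) this.1.le
  · exact mul_le_of_le_one_right (by positivity) this.2.le

/-- The nodal basis functions form a partition of unity on the cube. -/
theorem sum_nodalHat {m : ℕ} (hm : 1 ≤ m) {x : Space N} (hx : x ∈ cube N) :
    ∑ α, nodalHat m α x = 1 := by
  simp_rw [nodalHat_eq_prod hm]
  rw [sum_prod_multiIndex fun k a => tent (m * x k - (a : ℕ))]
  refine Finset.prod_eq_one fun k _ => ?_
  exact sum_tent hm (mul_mem_Icc_of_mem_cube hx k).1 (mul_mem_Icc_of_mem_cube hx k).2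

/-- Together with `sum_nodalHat`: multilinear interpolation reproduces affine functions. -/
theorem sum_nodalHat_smul_gridNode {m : ℕ} (hm : 1 ≤ m) {x : Space N} (hx : x ∈ cube N) :
    ∑ α, nodalHat m α x • gridNode m α = x := by
  have hm0 : (m : ℝ) ≠ 0 := by positivity
  ext j
  -- The factor `α j` is absorbed into the `j`-th factor of the product.
  have h1 : ∀ α : Fin N → Fin (m + 1), nodalHat m α x * gridNode m α j =
      (m : ℝ)⁻¹ * ∏ k, (if k = j then ((α k : ℕ) : ℝ) else 1) * tent (m * x k - (α k : ℕ)) := by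
    intro α
    rw [Finset.prod_mul_distrib, Finset.prod_ite_eq' Finset.univ j fun k => ((α k : ℕ) : ℝ),
      if_pos (Finset.mem_univ _), nodalHat_eq_prod hm, gridNode_apply]
    field_simp
  have h2 : (∑ α, nodalHat m α x • gridNode m α : Space N) j =
      ∑ α, nodalHat m α x * gridNode m α j := by
    rw [WithLp.ofLp_sum, Finset.sum_apply]; rfl
  rw [h2]
  simp_rw [h1]
  rw [← Finset.mul_sum, sum_prod_multiIndex fun k a =>
    (if k = j then ((a : ℕ) : ℝ) else 1) * tent (m * x k - (a : ℕ)),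
    Finset.prod_eq_single j]
  · simp only [if_true]
    rw [sum_coord_mul_tent hm (mul_mem_Icc_of_mem_cube hx j).1 (mul_mem_Icc_of_mem_cube hx j).2]
    field_simp
  · intro k _ hk
    simp only [if_neg hk, one_mul]
    exact sum_tent hm (mul_mem_Icc_of_mem_cube hx k).1 (mul_mem_Icc_of_mem_cube hx k).2
  · simp

theorem add_smul_basisVec_apply (x : Space N) (t : ℝ) (i k : Fin N) :
    (x + t • basisVec i) k = x k + if k = i then t else 0 := by
  simp [basisVec]

theorem nodalHat_eq_zero {m : ℕ} (hm : 1 ≤ m) {α : Fin N → Fin (m + 1)} {x : Space N}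
    {k : Fin N} (h : 1 / m ≤ |gridNode m α k - x k|) : nodalHat m α x = 0 := by
  have hm0 : (0 : ℝ) < m := by positivity
  rw [nodalHat_eq_prod hm]
  refine Finset.prod_eq_zero (Finset.mem_univ k) (tent_eq_zero ?_)
  rw [gridNode_apply, abs_sub_comm] at h
  have h2 : (m : ℝ) * x k - (α k : ℕ) = m * (x k - (α k : ℕ) / m) := by field_simp
  rw [h2, abs_mul, abs_of_pos hm0]
  rwa [div_le_iff₀' hm0] at h

theorem sum_abs_nodalHat_sub_le {m : ℕ} (hm : 1 ≤ m) {x : Space N} (hx : x ∈ cube N) (i : Fin N)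
    {t : ℝ} (ht : |t| ≤ 1 / m) :
    ∑ α, |nodalHat m α (x + t • basisVec i) - nodalHat m α x| ≤ 4 * m * |t| := by
  have hm0 : (0 : ℝ) < m := by positivity
  have h1 : ∀ α : Fin N → Fin (m + 1),
      |nodalHat m α (x + t • basisVec i) - nodalHat m α x| =
      ∏ k, if k = i then |tent (m * x i + m * t - (α k : ℕ)) - tent (m * x i - (α k : ℕ))|
        else tent (m * x k - (α k : ℕ)) := by
    intro α
    rw [nodalHat_eq_prod hm, nodalHat_eq_prod hm, ← Finset.mul_prod_erase _ _ (Finset.mem_univ i),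
      ← Finset.mul_prod_erase _ (fun k => tent (m * x k - (α k : ℕ))) (Finset.mem_univ i),
      ← Finset.mul_prod_erase _ (fun k => if k = i then _ else _) (Finset.mem_univ i)]
    have h2 : ∏ k ∈ Finset.univ.erase i, tent (m * (x + t • basisVec i) k - (α k : ℕ)) =
        ∏ k ∈ Finset.univ.erase i, tent (m * x k - (α k : ℕ)) := by
      refine Finset.prod_congr rfl fun k hk => ?_
      rw [add_smul_basisVec_apply, if_neg (Finset.ne_of_mem_erase hk), add_zero]
    rw [h2, ← sub_mul, abs_mul, abs_of_nonneg (Finset.prod_nonneg fun _ _ => tent_nonneg _),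
      add_smul_basisVec_apply, if_pos rfl, if_pos rfl, mul_add]
    congr 1
    refine Finset.prod_congr rfl fun k hk => ?_
    rw [if_neg (Finset.ne_of_mem_erase hk)]
  simp_rw [h1]
  rw [sum_prod_multiIndex fun k (a : Fin (m + 1)) => if k = i then
    |tent (m * x i + m * t - (a : ℕ)) - tent (m * x i - (a : ℕ))|
        else tent (m * x k - (a : ℕ)), Finset.prod_eq_single i]
  · simp only [if_true]
    have habs : |(m * x i + m * t) - m * x i| = m * |t| := by
      rw [add_sub_cancel_left, abs_mul, abs_of_pos hm0]
    refine (sum_abs_tent_sub_le m ?_).trans (le_of_eq ?_)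
    · rw [habs]; rwa [le_div_iff₀' hm0] at ht
    · rw [habs]; ring
  · intro k _ hk
    simp only [if_neg hk]
    exact sum_tent hm (mul_mem_Icc_of_mem_cube hx k).1 (mul_mem_Icc_of_mem_cube hx k).2
  · simp

theorem abs_nodalHat_sub_le {m : ℕ} (hm : 1 ≤ m) (α : Fin N → Fin (m + 1)) (x y : Space N) :
    |nodalHat m α x - nodalHat m α y| ≤ N * m * ‖x - y‖ := by
  rw [nodalHat_eq_prod hm, nodalHat_eq_prod hm]
  refine (abs_prod_sub_prod_le_sum _ (fun k => ⟨tent_nonneg _, tent_le_one _⟩)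
    fun k => ⟨tent_nonneg _, tent_le_one _⟩).trans ?_
  calc _ ≤ ∑ _k : Fin N, m * ‖x - y‖ := Finset.sum_le_sum fun k _ => by
        refine (abs_tent_sub_le _ _).trans ?_
        rw [sub_sub_sub_cancel_right, ← mul_sub, abs_mul, Nat.abs_cast]
        gcongr
        exact PiLp.norm_apply_le (x - y) k
    _ = _ := by simp; ring

/-- The multilinear spline that interpolates `f` at the nodes of the grid. -/
noncomputable def nodalInterp (m : ℕ) (f : Space N → ℝ) (x : Space N) : ℝ :=
  ∑ α, f (gridNode m α) * nodalHat m α x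

theorem exists_lipschitzWith_sum_mul_nodalHat {m : ℕ} (hm : 1 ≤ m)
    (c : (Fin N → Fin (m + 1)) → ℝ) : ∃ C, LipschitzWith C fun x => ∑ α, c α * nodalHat m α x := by
  refine ⟨_, LipschitzWith.of_dist_le' (K := ∑ α, |c α| * (N * m)) fun x y => ?_⟩
  rw [Real.dist_eq, dist_eq_norm, ← Finset.sum_sub_distrib, Finset.sum_mul]
  refine (Finset.abs_sum_le_sum_abs _ _).trans (Finset.sum_le_sum fun α _ => ?_)
  rw [← mul_sub, abs_mul, mul_assoc]
  gcongr
  exact abs_nodalHat_sub_le hm α x y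

theorem abs_nodalInterp_sub_le {m : ℕ} (hm : 1 ≤ m) {f : Space N → ℝ} {x : Space N}
    (hx : x ∈ cube N) {ε : ℝ} (hf : ∀ z, ‖z - x‖ ≤ 2 * N / m → |f z - f x| ≤ ε) :
    |nodalInterp m f x - f x| ≤ ε := by
  have h1 : nodalInterp m f x - f x = ∑ α, (f (gridNode m α) - f x) * nodalHat m α x := by
    simp_rw [sub_mul, Finset.sum_sub_distrib, ← Finset.mul_sum, sum_nodalHat hm hx, mul_one]
    rfl
  rw [h1]
  calc _ ≤ ∑ α, |(f (gridNode m α) - f x) * nodalHat m α x| := Finset.abs_sum_le_sum_abs _ _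
    _ ≤ ∑ α, ε * nodalHat m α x := Finset.sum_le_sum fun α _ => by
        by_cases h : ∀ k, |gridNode m α k - x k| ≤ 2 / m
        · rw [abs_mul, abs_of_nonneg (nodalHat_nonneg m α x)]
          refine mul_le_mul_of_nonneg_right (hf _ ?_) (nodalHat_nonneg m α x)
          refine (norm_le_sum_abs _).trans ?_
          calc _ ≤ ∑ _k : Fin N, 2 / (m : ℝ) := Finset.sum_le_sum fun k _ => h k
            _ = _ := by simp; ring
        · push Not at h
          obtain ⟨k, hk⟩ := h
          rw [nodalHat_eq_zero hm (k := k) (hk.le.trans' (by gcongr; norm_num))]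
          simp
    _ = ε := by rw [← Finset.mul_sum, sum_nodalHat hm hx, mul_one]

/-- The increments of the interpolant of `f` in a coordinate direction follow the derivative of
`f`. By reproduction of affine functions only the first-order Taylor remainders `R α` of `f` at `x`
remain, each at most `ε` times a multiple of the mesh size for the nodes near `x`, and they are
multiplied by the increments of the hats, whose total is at most a multiple of `|t|` divided by the
mesh size. -/
theorem abs_nodalInterp_add_sub_sub_le {m : ℕ} (hm : 1 ≤ m) {f : Space N → ℝ}
    (hf : Differentiable ℝ f) {x : Space N}
    (hx : x ∈ cube N) {ε : ℝ} (hε : 0 ≤ ε)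
    (hD : ∀ z, ‖z - x‖ ≤ 2 * N / m → ‖fderiv ℝ f z - fderiv ℝ f x‖ ≤ ε) (i : Fin N) {t : ℝ}
    (ht : |t| ≤ 1 / m) (hxt : x + t • basisVec i ∈ cube N) :
    |nodalInterp m f (x + t • basisVec i) - nodalInterp m f x - t * partialDeriv i f x| ≤
      8 * N * ε * |t| := by
  have hm0 : (0 : ℝ) < m := by positivity
  set y := x + t • basisVec i with hy
  set R : (Fin N → Fin (m + 1)) → ℝ := fun α =>
    f (gridNode m α) - f x - fderiv ℝ f x (gridNode m α - x) with hR
  -- Affine reproduction leaves only the interpolated Taylor remainder.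
  have hexp : ∀ z ∈ cube N, nodalInterp m f z =
      f x + fderiv ℝ f x (z - x) + ∑ α, R α * nodalHat m α z := by
    intro z hz
    have h1 : fderiv ℝ f x (z - x) = ∑ α, nodalHat m α z * fderiv ℝ f x (gridNode m α - x) := by
      conv_lhs => rw [← sum_nodalHat_smul_gridNode hm hz]
      have : (∑ α, nodalHat m α z • gridNode m α) - x =
          ∑ α, nodalHat m α z • (gridNode m α - x) := by
        simp_rw [smul_sub, Finset.sum_sub_distrib, ← Finset.sum_smul, sum_nodalHat hm hz, one_smul]
      rw [this, map_sum]
      simp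
    have h2 : f x = ∑ α : Fin N → Fin (m + 1), f x * nodalHat m α z := by
      rw [← Finset.mul_sum, sum_nodalHat hm hz, mul_one]
    rw [h1]
    conv_rhs => rw [h2]
    rw [← Finset.sum_add_distrib, ← Finset.sum_add_distrib]
    refine Finset.sum_congr rfl fun α _ => ?_
    rw [hR]; ring
  have hlin : fderiv ℝ f x (y - x) = t * partialDeriv i f x := by
    rw [hy, add_sub_cancel_left, map_smul, smul_eq_mul, partialDeriv]
  have heq : nodalInterp m f y - nodalInterp m f x - t * partialDeriv i f x =
      ∑ α, R α * (nodalHat m α y - nodalHat m α x) := by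
    rw [hexp y hxt, hexp x hx, hlin]
    simp_rw [mul_sub, Finset.sum_sub_distrib]
    rw [sub_self, map_zero]
    ring
  rw [heq]
  calc _ ≤ ∑ α, |R α * (nodalHat m α y - nodalHat m α x)| := Finset.abs_sum_le_sum_abs _ _
    _ ≤ ∑ α, (ε * (2 * N / m)) * |nodalHat m α y - nodalHat m α x| :=
      Finset.sum_le_sum fun α _ => by
        rw [abs_mul]
        by_cases h : ∀ k, |gridNode m α k - x k| ≤ 2 / m
        · refine mul_le_mul_of_nonneg_right ?_ (abs_nonneg _)
          have hnorm : ‖gridNode m α - x‖ ≤ 2 * N / m := by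
            refine (norm_le_sum_abs _).trans ?_
            calc _ ≤ ∑ _k : Fin N, 2 / (m : ℝ) := Finset.sum_le_sum fun k _ => h k
              _ = _ := by simp; ring
          have := (convex_closedBall x (2 * N / m : ℝ)).norm_image_sub_le_of_norm_fderiv_le'
            (𝕜 := ℝ) (f := f) (φ := fderiv ℝ f x) (C := ε) (x := x) (y := gridNode m α)
            (fun z _ => hf z) (fun z hz => hD z (mem_closedBall_iff_norm.1 hz))
            (Metric.mem_closedBall_self (by positivity)) (mem_closedBall_iff_norm.2 hnorm)
          exact this.trans (by gcongr)
        · push Not at h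
          obtain ⟨k, hk⟩ := h
          -- A node this far from `x` in some coordinate lies outside both supports.
          have hyk : |y k - x k| ≤ 1 / m := by
            rw [hy, add_smul_basisVec_apply, add_sub_cancel_left]
            split_ifs
            · exact ht
            · rw [abs_zero]; positivity
          have h12 : (2 : ℝ) / m = 1 / m + 1 / m := by ring
          have h3 : |gridNode m α k - x k| ≤ |gridNode m α k - y k| + |y k - x k| :=
            abs_sub_le _ _ _
          have hpos : 0 < 1 / (m : ℝ) := by positivity
          rw [nodalHat_eq_zero hm (k := k) (x := x) (by linarith),
            nodalHat_eq_zero hm (k := k) (x := y) (by linarith)]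
          simp
    _ ≤ (ε * (2 * N / m)) * (4 * m * |t|) := by
        rw [← Finset.mul_sum]
        gcongr
        exact sum_abs_nodalHat_sub_le hm hx i ht
    _ = 8 * N * ε * |t| := by field_simp; ring

theorem abs_lineDeriv_nodalInterp_sub_le {m : ℕ} (hm : 1 ≤ m) {f : Space N → ℝ}
    (hf : Differentiable ℝ f) {x : Space N} (hx : x ∈ cube N) {ε : ℝ} (hε : 0 ≤ ε)
    (hD : ∀ z, ‖z - x‖ ≤ 2 * N / m → ‖fderiv ℝ f z - fderiv ℝ f x‖ ≤ ε) (i : Fin N)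
    (hdiff : LineDifferentiableAt ℝ (nodalInterp m f) x (basisVec i)) :
    |lineDeriv ℝ (nodalInterp m f) x (basisVec i) - partialDeriv i f x| ≤ 8 * N * ε := by
  have hm0 : (0 : ℝ) < m := by positivity
  have hg : HasDerivAt (fun t : ℝ => nodalInterp m f (x + t • basisVec i) - t * partialDeriv i f x)
      (lineDeriv ℝ (nodalInterp m f) x (basisVec i) - 1 * partialDeriv i f x) 0 :=
    HasDerivAt.sub (show HasDerivAt _ _ _ from hdiff.hasLineDerivAt) ((hasDerivAt_id 0).mul_const _)
  rw [one_mul] at hg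
  refine hg.le_of_lip' (C := 8 * N * ε) (by positivity) ?_
  have hcont : Continuous fun t : ℝ => x + t • basisVec i := by fun_prop
  have h1 : ∀ᶠ t : ℝ in 𝓝 0, x + t • basisVec i ∈ cube N := by
    refine hcont.continuousAt.eventually_mem ((isOpen_cube N).mem_nhds ?_)
    simpa using hx
  have h2 : ∀ᶠ t : ℝ in 𝓝 0, |t| ≤ 1 / m := by
    have : Set.Icc (-(1 / m : ℝ)) (1 / m) ∈ 𝓝 (0 : ℝ) :=
      Icc_mem_nhds (by simpa using hm0) (by positivity)
    filter_upwards [this] with t ht using abs_le.2 ht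
  filter_upwards [h1, h2] with t ht1 ht2
  have := abs_nodalInterp_add_sub_sub_le hm hf hx hε hD i ht2 ht1
  rw [Real.norm_eq_abs, Real.norm_eq_abs, sub_zero]
  refine le_trans (le_of_eq ?_) this
  congr 1
  simp only [zero_smul, add_zero, zero_mul, sub_zero]
  ring

/-- For a compactly supported `C¹` function the nodal interpolants converge uniformly on the cube,
and so do their partial derivatives wherever these exist. -/
theorem eventually_nodalInterp_close {f : Space N → ℝ} (hf : ContDiff ℝ 1 f)
    (hs : HasCompactSupport f) {ε : ℝ} (hε : 0 < ε) :
    ∀ᶠ m : ℕ in atTop, ∀ x ∈ cube N, |nodalInterp m f x - f x| ≤ ε ∧ ∀ i,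
      LineDifferentiableAt ℝ (nodalInterp m f) x (basisVec i) →
      |lineDeriv ℝ (nodalInterp m f) x (basisVec i) - partialDeriv i f x| ≤ ε := by
  have hu : UniformContinuous f := hs.uniformContinuous_of_continuous hf.continuous
  have hu' : UniformContinuous (fderiv ℝ f) :=
    (hs.fderiv ℝ).uniformContinuous_of_continuous (hf.continuous_fderiv (by simp))
  set ε' : ℝ := ε / (8 * (N + 1)) with hε'
  have hε'0 : 0 < ε' := by positivity
  obtain ⟨δ₁, hδ₁, h₁⟩ := Metric.uniformContinuous_iff.1 hu ε hε
  obtain ⟨δ₂, hδ₂, h₂⟩ := Metric.uniformContinuous_iff.1 hu' ε' hε'0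
  have hlim : Tendsto (fun m : ℕ => (2 * N : ℝ) / m) atTop (𝓝 0) :=
    tendsto_const_div_atTop_nhds_zero_nat _
  filter_upwards [eventually_ge_atTop 1, hlim.eventually_lt_const hδ₁,
    hlim.eventually_lt_const hδ₂] with m hm hm1 hm2 x hx
  refine ⟨abs_nodalInterp_sub_le hm hx fun z hz => ?_, fun i hi => ?_⟩
  · exact (h₁ (show dist z x < δ₁ by rw [dist_eq_norm]; linarith)).le
  · refine (abs_lineDeriv_nodalInterp_sub_le hm (hf.differentiable (by simp)) hx hε'0.le
      (fun z hz => ?_) i hi).trans ?_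
    · rw [← dist_eq_norm]
      exact (h₂ (show dist z x < δ₂ by rw [dist_eq_norm]; linarith)).le
    · rw [hε']
      calc 8 * N * (ε / (8 * (N + 1))) = ε * (N / (N + 1)) := by field_simp
        _ ≤ ε * 1 := by
          gcongr
          rw [div_le_one (by positivity)]; linarith
        _ = ε := mul_one _

/-! ### Contraction and mollification -/

/-- A smooth bump function at the origin supported in the ball of radius `δ / 2`. -/
noncomputable def cubeBump (N : ℕ) {δ : ℝ} (hδ : 0 < δ) : ContDiffBump (0 : Space N) :=
  ⟨δ / 4, δ / 2, by linarith, by linarith⟩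

/-- The mollification kernel: a smooth probability density supported in the ball of radius `δ / 2`.
-/
noncomputable def kernel (N : ℕ) {δ : ℝ} (hδ : 0 < δ) : Space N → ℝ :=
  (cubeBump N hδ).normed volume

/-- The contraction of ratio `1 - 2δ` towards the centre of the unit cube. For `δ < 1 / 2` it maps
the cube to its points at distance more than `δ` from the boundary. -/
noncomputable def contraction {N : ℕ} (δ : ℝ) (x : Space N) : Space N :=
  (1 - 2 * δ) • x + δ • WithLp.toLp 2 fun _ => 1

/-- The mollification of `f` by `kernel N hδ`, evaluated at the contracted point. For `δ ≤ 1 / 4`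
and `x` in the cube it only involves the values of `f` inside the cube. -/
noncomputable def contractMollify {N : ℕ} {δ : ℝ} (hδ : 0 < δ) (f : Space N → ℝ)
    (x : Space N) : ℝ :=
  (f ⋆[ContinuousLinearMap.mul ℝ ℝ, volume] kernel N hδ) (contraction δ x)

variable {δ : ℝ}

theorem kernel_nonneg (hδ : 0 < δ) (x : Space N) : 0 ≤ kernel N hδ x :=
  (cubeBump N hδ).nonneg_normed x

theorem contDiff_kernel (hδ : 0 < δ) : ContDiff ℝ ∞ (kernel N hδ) :=
  (cubeBump N hδ).contDiff_normed

theorem continuous_kernel (hδ : 0 < δ) : Continuous (kernel N hδ) := (contDiff_kernel hδ).continuous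

theorem hasCompactSupport_kernel (hδ : 0 < δ) : HasCompactSupport (kernel N hδ) :=
  (cubeBump N hδ).hasCompactSupport_normed

theorem integrable_kernel (hδ : 0 < δ) : Integrable (kernel N hδ) :=
  (cubeBump N hδ).integrable_normed

theorem integral_kernel (hδ : 0 < δ) : ∫ x, kernel N hδ x = 1 :=
  (cubeBump N hδ).integral_normed

theorem tsupport_kernel (hδ : 0 < δ) : tsupport (kernel N hδ) = Metric.closedBall 0 (δ / 2) :=
  (cubeBump N hδ).tsupport_normed_eq

theorem contraction_apply (x : Space N) (k : Fin N) :
    contraction δ x k = (1 - 2 * δ) * x k + δ := by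
  simp [contraction]

theorem continuous_contraction : Continuous (contraction (N := N) δ) := by
  unfold contraction; fun_prop

theorem contractMollify_apply (hδ : 0 < δ) (f : Space N → ℝ) (x : Space N) :
    contractMollify hδ f x = ∫ y, f y * kernel N hδ (contraction δ x - y) := by
  rw [contractMollify, convolution_mul]

theorem contDiff_contractMollify (hδ : 0 < δ) {f : Space N → ℝ} (hf : LocallyIntegrable f) :
    ContDiff ℝ 1 (contractMollify hδ f) := by
  have h := (hasCompactSupport_kernel (N := N) hδ).contDiff_convolution_right (n := 1)
    (ContinuousLinearMap.mul ℝ ℝ) hf ((contDiff_kernel hδ).of_le (by simp))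
  have hc : ContDiff ℝ 1 (contraction (N := N) δ) := by unfold contraction; fun_prop
  exact ContDiff.comp h hc

theorem hasCompactSupport_contractMollify (hδ : 0 < δ) (hδ2 : δ ≤ 1 / 4) {f : Space N → ℝ}
    (hf : HasCompactSupport f) : HasCompactSupport (contractMollify hδ f) := by
  have h := hf.convolution (μ := volume) (ContinuousLinearMap.mul ℝ ℝ)
    (hasCompactSupport_kernel (N := N) hδ)
  have hne : 1 - 2 * δ ≠ 0 := by linarith
  exact h.comp_homeomorph ((Homeomorph.smulOfNeZero (1 - 2 * δ) hne).trans
    (Homeomorph.addRight (δ • WithLp.toLp 2 fun _ : Fin N => (1 : ℝ))))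

theorem partialDeriv_contractMollify (hδ : 0 < δ) {f : Space N → ℝ} (hf : LocallyIntegrable f)
    (i : Fin N) (x : Space N) :
    partialDeriv i (contractMollify hδ f) x =
      (1 - 2 * δ) * ∫ y, f y * partialDeriv i (kernel N hδ) (contraction δ x - y) := by
  have hk1 : ContDiff ℝ 1 (kernel N hδ) := (contDiff_kernel hδ).of_le (by simp)
  have h := (hasCompactSupport_kernel (N := N) hδ).hasFDerivAt_convolution_right
    (ContinuousLinearMap.mul ℝ ℝ) hf hk1 (contraction δ x)
  have hc : HasFDerivAt (contraction (N := N) δ)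
      ((1 - 2 * δ) • ContinuousLinearMap.id ℝ (Space N)) x := by
    unfold contraction
    exact ((hasFDerivAt_id (𝕜 := ℝ) x).const_smul (1 - 2 * δ)).add_const _
  have h2 := (HasFDerivAt.comp x h hc).fderiv
  rw [partialDeriv]
  change (fderiv ℝ ((f ⋆[ContinuousLinearMap.mul ℝ ℝ, volume] kernel N hδ) ∘ contraction δ) x) _ = _
  rw [h2, ContinuousLinearMap.comp_apply, smul_apply, map_smul, smul_eq_mul,
    ContinuousLinearMap.id_apply, convolution_precompR_apply _ hf
      ((hasCompactSupport_kernel hδ).fderiv ℝ) (hk1.continuous_fderiv (by simp)), convolution_mul]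
  rfl

theorem mem_cube_of_dist_contraction_le (hδ : 0 < δ) (hδ2 : δ ≤ 1 / 4) {x y : Space N}
    (hx : x ∈ cube N) (hy : ‖contraction δ x - y‖ ≤ δ / 2) : y ∈ cube N := by
  intro k
  have h1 : |contraction δ x k - y k| ≤ δ / 2 :=
    (PiLp.norm_apply_le (contraction δ x - y) k).trans hy
  rw [contraction_apply, abs_le] at h1
  have := hx k
  constructor <;> nlinarith [this.1, this.2]

theorem isTestFunction_kernel_sub (hδ : 0 < δ) (hδ2 : δ ≤ 1 / 4) {x : Space N} (hx : x ∈ cube N) :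
    IsTestFunction fun y => kernel N hδ (contraction δ x - y) := by
  have hcd : ContDiff ℝ ∞ fun y => kernel N hδ (contraction δ x - y) :=
    (contDiff_kernel hδ).comp (contDiff_const.sub contDiff_id)
  have hsub : (tsupport fun y => kernel N hδ (contraction δ x - y)) ⊆
      {y | ‖contraction δ x - y‖ ≤ δ / 2} := by
    refine closure_minimal (fun y hy => ?_) (isClosed_le (by fun_prop) continuous_const)
    have : contraction δ x - y ∈ tsupport (kernel N hδ) := subset_tsupport _ hy
    rw [tsupport_kernel] at this
    simpa using this
  have hsub' := hsub.trans fun y hy => mem_cube_of_dist_contraction_le hδ hδ2 hx hy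
  exact ⟨hcd, Metric.isCompact_of_isClosed_isBounded (isClosed_tsupport _)
        ((isBounded_cube N).subset hsub'), hsub'⟩

theorem partialDeriv_kernel_sub (hδ : 0 < δ) (z y : Space N) (i : Fin N) :
    partialDeriv i (fun y => kernel N hδ (z - y)) y = - partialDeriv i (kernel N hδ) (z - y) := by
  have h1 : HasFDerivAt (kernel N hδ) (fderiv ℝ (kernel N hδ) (z - y)) (z - y) :=
    ((contDiff_kernel hδ).differentiable (by simp) _).hasFDerivAt
  have h2 : HasFDerivAt (fun y : Space N => z - y) (-ContinuousLinearMap.id ℝ (Space N)) y :=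
    (hasFDerivAt_id y).const_sub z
  have h3 := (HasFDerivAt.comp y h1 h2).fderiv
  rw [partialDeriv, partialDeriv]
  change (fderiv ℝ (kernel N hδ ∘ fun y => z - y) y) _ = _
  rw [h3]
  simp

/-- Symmetric derivatives of contracted mollifications of `u` are contracted mollifications of the
measures `E_ij u`: for `x` in the cube the translated kernel is a test function, because of the
contraction. -/
theorem symPartial_contractMollify_eq (hδ : 0 < δ) (hδ2 : δ ≤ 1 / 4) {u : Space N → Space N}
    (hu : IntegrableOn u (cube N)) {i j : Fin N} {μ : SignedMeasure (Space N)}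
    (hμ : IsSymDeriv u i j μ) {x : Space N} (hx : x ∈ cube N) :
    (1 / 2 : ℝ) * (partialDeriv i (contractMollify hδ ((cube N).indicator fun y => u y j)) x +
      partialDeriv j (contractMollify hδ ((cube N).indicator fun y => u y i)) x) =
    (1 - 2 * δ) * ∫ᵛ y, kernel N hδ (contraction δ x - y) ∂<•μ := by
  have hcomp : ∀ k : Fin N, IntegrableOn (fun x => u x k) (cube N) := fun k =>
    (EuclideanSpace.proj k : Space N →L[ℝ] ℝ).integrable_comp hu
  have hind : ∀ k : Fin N, LocallyIntegrable ((cube N).indicator fun y => u y k) := fun k =>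
    ((integrable_indicator_iff (measurableSet_cube N)).2 (hcomp k)).locallyIntegrable
  have hset : ∀ k l : Fin N,
      ∫ y, (cube N).indicator (fun y => u y k) y *
        partialDeriv l (kernel N hδ) (contraction δ x - y) =
      ∫ y in cube N, u y k * partialDeriv l (kernel N hδ) (contraction δ x - y) := by
    intro k l
    rw [← integral_indicator (measurableSet_cube N)]
    congr 1 with y
    by_cases hy : y ∈ cube N <;> simp [hy]
  have hint : ∀ k l : Fin N, IntegrableOn
      (fun y => u y k * partialDeriv l (kernel N hδ) (contraction δ x - y)) (cube N) := by
    intro k l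
    have hc : Continuous (partialDeriv l (kernel N hδ)) :=
      ((contDiff_kernel hδ).continuous_fderiv (by simp)).clm_apply continuous_const
    have hs : HasCompactSupport (partialDeriv l (kernel N hδ)) :=
      (hasCompactSupport_kernel hδ).fderiv_apply (𝕜 := ℝ) (basisVec l)
    obtain ⟨C, hC⟩ := hs.exists_bound_of_continuous hc
    exact (hcomp k).mul_bdd (hc.comp (by fun_prop)).aestronglyMeasurable (ae_of_all _ fun y => hC _)
  rw [partialDeriv_contractMollify hδ (hind j), partialDeriv_contractMollify hδ (hind i),
    hset, hset, hμ.2 _ (isTestFunction_kernel_sub hδ hδ2 hx), ← mul_add,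
    ← integral_add (hint j i) (hint i j)]
  simp_rw [partialDeriv_kernel_sub]
  rw [← integral_neg, mul_left_comm, ← integral_const_mul]
  congr 2 with y
  ring

theorem lintegral_kernel_contraction_sub (hδ : 0 < δ) (hδ2 : δ ≤ 1 / 4) (y : Space N) :
    ∫⁻ x, ENNReal.ofReal (kernel N hδ (contraction δ x - y)) =
      ENNReal.ofReal (((1 - 2 * δ) ^ N)⁻¹) := by
  have hne : 0 < 1 - 2 * δ := by linarith
  set b : Space N := δ • WithLp.toLp 2 fun _ => 1
  have heq : ∀ x : Space N, kernel N hδ (contraction δ x - y) =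
      (fun z => kernel N hδ (z + (b - y))) ((1 - 2 * δ) • x) := fun x => by
    simp only [contraction, b, add_sub_assoc]
  simp_rw [heq]
  have hi : Integrable fun z => kernel N hδ (z + (b - y)) :=
    (integrable_kernel hδ).comp_add_right (b - y)
  rw [← ofReal_integral_eq_lintegral_ofReal ((integrable_comp_smul_iff volume _ hne.ne').2 hi)
    (ae_of_all _ fun x => kernel_nonneg hδ _), 
    Measure.integral_comp_smul volume fun z => kernel N hδ (z + (b - y)),
    integral_add_right_eq_self (kernel N hδ) (b - y), integral_kernel, finrank_euclideanSpace_fin,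
    smul_eq_mul, mul_one, abs_of_pos (by positivity)]

/-- Contracted mollification multiplies the total mass by the inverse Jacobian `(1 - 2δ) ^ (-N)` of
the contraction. This gives both the total variation bound and the `L^r` bound. -/
theorem lintegral_lintegral_kernel (hδ : 0 < δ) (hδ2 : δ ≤ 1 / 4) (ν : Measure (Space N))
    [SFinite ν] {h : Space N → ℝ≥0∞} (hh : AEMeasurable h ν) :
    ∫⁻ x, ∫⁻ y, ENNReal.ofReal (kernel N hδ (contraction δ x - y)) * h y ∂ν =
      ENNReal.ofReal (((1 - 2 * δ) ^ N)⁻¹) * ∫⁻ y, h y ∂ν := by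
  have hk : Continuous fun p : Space N × Space N => kernel N hδ (contraction δ p.1 - p.2) :=
    (continuous_kernel hδ).comp ((continuous_contraction.comp continuous_fst).sub continuous_snd)
  have hm : AEMeasurable (Function.uncurry fun x y =>
      ENNReal.ofReal (kernel N hδ (contraction δ x - y)) * h y) (volume.prod ν) :=
    hk.measurable.ennreal_ofReal.aemeasurable.mul hh.comp_snd
  rw [lintegral_lintegral_swap hm, ← lintegral_const_mul'' _ hh]
  refine lintegral_congr fun y => ?_
  have hk' : Measurable fun x : Space N => ENNReal.ofReal (kernel N hδ (contraction δ x - y)) :=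
    ((continuous_kernel hδ).comp
      (continuous_contraction.sub continuous_const)).measurable.ennreal_ofReal
  rw [lintegral_mul_const _ hk', lintegral_kernel_contraction_sub hδ hδ2]

theorem lintegral_symPartial_contractMollify_le (hδ : 0 < δ) (hδ2 : δ ≤ 1 / 4)
    {u : Space N → Space N} (hu : IntegrableOn u (cube N)) {i j : Fin N}
    {μ : SignedMeasure (Space N)} (hμ : IsSymDeriv u i j μ) :
    ∫⁻ x in cube N, ‖(1 / 2 : ℝ) *
      (partialDeriv i (contractMollify hδ ((cube N).indicator fun y => u y j)) x +
        partialDeriv j (contractMollify hδ ((cube N).indicator fun y => u y i)) x)‖ₑ ≤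
      ENNReal.ofReal (((1 - 2 * δ) ^ N)⁻¹) * μ.totalVariation (cube N) := by
  calc _ ≤ ∫⁻ x in cube N, ∫⁻ y, ENNReal.ofReal (kernel N hδ (contraction δ x - y)) * 1
          ∂μ.totalVariation := by
        refine setLIntegral_mono' (measurableSet_cube N) fun x hx => ?_
        rw [symPartial_contractMollify_eq hδ hδ2 hu hμ hx, enorm_mul]
        have h1 : ‖1 - 2 * δ‖ₑ ≤ 1 := by
          rw [← ofReal_norm, Real.norm_eq_abs, abs_of_nonneg (by linarith)]
          exact ENNReal.ofReal_le_one.2 (by linarith)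
        refine (mul_le_mul' h1 (enorm_integral_le_lintegral_totalVariation _ _)).trans ?_
        rw [one_mul]
        refine lintegral_mono fun y => ?_
        rw [mul_one, Real.enorm_of_nonneg (kernel_nonneg hδ _)]
    _ ≤ ∫⁻ x, ∫⁻ y, ENNReal.ofReal (kernel N hδ (contraction δ x - y)) * 1 ∂μ.totalVariation :=
        setLIntegral_le_lintegral _ _
    _ = _ := by
        rw [lintegral_lintegral_kernel hδ hδ2 _ aemeasurable_const, lintegral_one,
          ← measure_add_measure_compl (measurableSet_cube N), hμ.1, add_zero]

/-- The Jensen inequality for the probability density `y ↦ kernel N hδ (contraction δ x - y)`. -/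
theorem enorm_contractMollify_rpow_le (hδ : 0 < δ) {f : Space N → ℝ}
    (hf : AEStronglyMeasurable f) {r : ℝ} (hr : 1 ≤ r) (x : Space N) :
    ‖contractMollify hδ f x‖ₑ ^ r ≤
      ∫⁻ y, ENNReal.ofReal (kernel N hδ (contraction δ x - y)) * ‖f y‖ₑ ^ r := by
  set κ : Space N → ℝ≥0∞ := fun y => ENNReal.ofReal (kernel N hδ (contraction δ x - y)) with hκ
  have hκm : Measurable κ :=
    ((continuous_kernel hδ).comp (continuous_const.sub continuous_id)).measurable.ennreal_ofReal
  have hprob : IsProbabilityMeasure (volume.withDensity κ) := by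
    constructor
    rw [withDensity_apply _ MeasurableSet.univ, Measure.restrict_univ,
      ← ofReal_integral_eq_lintegral_ofReal ((integrable_kernel hδ).comp_sub_left _)
      (ae_of_all _ fun y => kernel_nonneg hδ _), integral_sub_left_eq_self (kernel N hδ),
      integral_kernel, ENNReal.ofReal_one]
  have hfν : AEStronglyMeasurable f (volume.withDensity κ) :=
    hf.mono_ac (withDensity_absolutelyContinuous _ _)
  have h1 : ‖contractMollify hδ f x‖ₑ ≤ eLpNorm' f 1 (volume.withDensity κ) := by
    rw [eLpNorm', contractMollify_apply]
    simp only [ENNReal.rpow_one, div_one]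
    rw [lintegral_withDensity_eq_lintegral_mul₀ hκm.aemeasurable hf.enorm]
    refine (enorm_integral_le_lintegral_enorm _).trans (le_of_eq (lintegral_congr fun y => ?_))
    rw [enorm_mul, mul_comm, Real.enorm_of_nonneg (kernel_nonneg hδ _)]
    rfl
  have h2 := h1.trans (eLpNorm'_le_eLpNorm'_of_exponent_le zero_lt_one hr _ hfν)
  calc _ ≤ (eLpNorm' f r (volume.withDensity κ)) ^ r := ENNReal.rpow_le_rpow h2 (by linarith)
    _ = ∫⁻ y, ‖f y‖ₑ ^ r ∂(volume.withDensity κ) := by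
        rw [eLpNorm', ← ENNReal.rpow_mul, one_div_mul_cancel (by linarith), ENNReal.rpow_one]
    _ = _ := lintegral_withDensity_eq_lintegral_mul₀ hκm.aemeasurable (hf.enorm.pow_const r)

theorem eLpNorm_contractMollify_le (hδ : 0 < δ) (hδ2 : δ ≤ 1 / 4) {f : Space N → ℝ}
    (hf : AEStronglyMeasurable f) {r : ℝ} (hr : 1 ≤ r) :
    eLpNorm (contractMollify hδ f) (ENNReal.ofReal r) volume ≤
      2 ^ N * eLpNorm f (ENNReal.ofReal r) volume := by
  have hr0 : 0 < r := by linarith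
  have hp0 : ENNReal.ofReal r ≠ 0 := by simpa using hr0
  rw [eLpNorm_eq_lintegral_rpow_enorm_toReal hp0 ENNReal.ofReal_ne_top,
    eLpNorm_eq_lintegral_rpow_enorm_toReal hp0 ENNReal.ofReal_ne_top, ENNReal.toReal_ofReal hr0.le]
  have hc : ENNReal.ofReal (((1 - 2 * δ) ^ N)⁻¹) ≤ 2 ^ N := by
    rw [← ENNReal.ofReal_ofNat 2, ← ENNReal.ofReal_pow (by norm_num)]
    apply ENNReal.ofReal_le_ofReal
    rw [← inv_pow]
    have h1 : (1 - 2 * δ)⁻¹ ≤ 2 := by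
      rw [inv_le_comm₀ (by linarith) (by norm_num)]; linarith
    exact pow_le_pow_left₀ (inv_nonneg.2 (by linarith)) h1 N
  have hone : (1 : ℝ≥0∞) ≤ 2 ^ N := one_le_pow₀ (by norm_num)
  calc _ ≤ (2 ^ N * ∫⁻ y, ‖f y‖ₑ ^ r) ^ (1 / r) := by
        refine ENNReal.rpow_le_rpow ?_ (by positivity)
        refine (lintegral_mono (enorm_contractMollify_rpow_le hδ hf hr)).trans ?_
        rw [lintegral_lintegral_kernel hδ hδ2 volume (hf.enorm.pow_const r)]
        gcongr
    _ ≤ _ := by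
        rw [ENNReal.mul_rpow_of_nonneg _ _ (by positivity)]
        gcongr
        calc ((2 : ℝ≥0∞) ^ N) ^ (1 / r) ≤ ((2 : ℝ≥0∞) ^ N) ^ (1 : ℝ) :=
              ENNReal.rpow_le_rpow_of_exponent_le hone ((div_le_one hr0).2 hr)
          _ = _ := ENNReal.rpow_one _

theorem norm_contraction_sub_le (hδ : 0 < δ) {x : Space N} (hx : x ∈ cube N) :
    ‖contraction δ x - x‖ ≤ N * δ := by
  refine (norm_le_sum_abs _).trans ?_
  calc _ ≤ ∑ _k : Fin N, δ := Finset.sum_le_sum fun k _ => by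
        rw [PiLp.sub_apply, contraction_apply, abs_le]
        have := hx k
        constructor <;> nlinarith [this.1, this.2]
    _ = _ := by simp

theorem eventually_contractMollify_close {g : Space N → ℝ} (hg : Continuous g)
    (hs : HasCompactSupport g) {ε : ℝ} (hε : 0 < ε) :
    ∀ᶠ δ in 𝓝[>] (0 : ℝ), ∀ hδ : 0 < δ, ∀ x ∈ cube N, |contractMollify hδ g x - g x| ≤ ε := by
  obtain ⟨η, hη, h⟩ := Metric.uniformContinuous_iff.1 (hs.uniformContinuous_of_continuous hg)
    (ε / 2) (by positivity)
  have hmem : Set.Ioo (0 : ℝ) (η / (N + 1)) ∈ 𝓝[>] (0 : ℝ) := Ioo_mem_nhdsGT (by positivity)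
  filter_upwards [hmem] with δ hδ' hδ x hx
  have hδ0 := hδ'.2
  rw [lt_div_iff₀ (by positivity)] at hδ0
  have hNδ : 0 ≤ N * δ := by positivity
  have h1 : dist (contractMollify hδ g x) (g (contraction δ x)) ≤ ε / 2 := by
    have := (cubeBump N hδ).dist_normed_convolution_le (μ := volume) (g := g)
      (x₀ := contraction δ x) (ε := ε / 2) hg.aestronglyMeasurable (fun z hz => (h ?_).le)
    · rw [contractMollify, convolution_mul_swap]
      rw [convolution_lsmul] at this
      simp_rw [mul_comm]
      exact this
    · have hz' : dist z (contraction δ x) < δ / 2 := hz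
      linarith
  have h2 : dist (g (contraction δ x)) (g x) < ε / 2 := by
    refine h ?_
    rw [dist_eq_norm]
    have := norm_contraction_sub_le hδ hx
    linarith
  rw [← Real.dist_eq]
  linarith [dist_triangle (contractMollify hδ g x) (g (contraction δ x)) (g x)]

theorem contractMollify_sub (hδ : 0 < δ) {f g : Space N → ℝ} (hf : LocallyIntegrable f)
    (hg : LocallyIntegrable g) :
    contractMollify hδ (f - g) = contractMollify hδ f - contractMollify hδ g := by
  ext x
  have hex : ∀ {f : Space N → ℝ}, LocallyIntegrable f →
      Integrable fun y => f y * kernel N hδ (contraction δ x - y) := fun hf =>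
    (hasCompactSupport_kernel hδ).convolutionExists_right (ContinuousLinearMap.mul ℝ ℝ) hf
      (continuous_kernel hδ) (contraction δ x)
  rw [Pi.sub_apply, contractMollify_apply, contractMollify_apply, contractMollify_apply,
    ← integral_sub (hex hf) (hex hg)]
  simp_rw [Pi.sub_apply, sub_mul]

theorem volume_cube : volume (cube N) = 1 := by
  have h : cube N = (WithLp.ofLp : Space N → Fin N → ℝ) ⁻¹' Set.univ.pi fun _ => Set.Ioo 0 1 := by
    ext x; simp [cube]
  rw [h, (PiLp.volume_preserving_ofLp (Fin N)).measure_preimage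
    (MeasurableSet.univ_pi fun _ => measurableSet_Ioo).nullMeasurableSet, volume_pi_pi]
  simp

instance isProbabilityMeasure_restrict_cube : IsProbabilityMeasure (volume.restrict (cube N)) :=
  ⟨by rw [Measure.restrict_apply_univ, volume_cube]⟩

theorem eLpNorm_cube_le_of_bound {f : Space N → ℝ} {C : ℝ} (hC : ∀ x ∈ cube N, |f x| ≤ C)
    (p : ℝ≥0∞) : eLpNorm f p (volume.restrict (cube N)) ≤ ENNReal.ofReal C := by
  refine (eLpNorm_le_of_ae_bound (C := C) ?_).trans ?_
  · exact (ae_restrict_iff' (measurableSet_cube N)).2 (ae_of_all _ hC)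
  · rw [Measure.restrict_apply_univ]
    rw [volume_cube, ENNReal.one_rpow, one_mul]

theorem eventually_eLpNorm_contractMollify_sub_le {f : Space N → ℝ} {r : ℝ} (hr : 1 ≤ r)
    (hf : MemLp f (ENNReal.ofReal r) volume) {ε : ℝ} (hε : 0 < ε) :
    ∀ᶠ δ in 𝓝[>] (0 : ℝ), ∀ hδ : 0 < δ,
      eLpNorm (contractMollify hδ f - f) (ENNReal.ofReal r) (volume.restrict (cube N)) ≤
        ENNReal.ofReal ε := by
  have hp1 : 1 ≤ ENNReal.ofReal r := by simpa using hr
  set η : ℝ := ε / (3 * 2 ^ N) with hηdef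
  have hη : 0 < η := by positivity
  have hη' : η ≤ ε / 3 := by
    rw [hηdef]
    refine div_le_div_of_nonneg_left hε.le (by norm_num) ?_
    have : (1 : ℝ) ≤ 2 ^ N := one_le_pow₀ (by norm_num)
    linarith
  -- Split off a continuous compactly supported `g`; the factor `2 ^ N` in `η` compensates the bound
  -- of `eLpNorm_contractMollify_le` for the remaining part `f - g`.
  obtain ⟨g, hgs, hgc, hg, hgL⟩ := hf.exists_hasCompactSupport_eLpNorm_sub_le
    ENNReal.ofReal_ne_top (show ENNReal.ofReal η ≠ 0 by simpa using hη)
  have hmem : Set.Ioo (0 : ℝ) (1 / 4) ∈ 𝓝[>] (0 : ℝ) := Ioo_mem_nhdsGT (by norm_num)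
  filter_upwards [hmem, eventually_contractMollify_close hg hgs (show 0 < ε / 3 by positivity)]
    with δ hδ' h₁ hδ
  have hδ2 := hδ'.2.le
  have hfl := hf.locallyIntegrable hp1
  have hgl := hg.locallyIntegrable (μ := (volume : Measure (Space N)))
  have hc : ∀ {h : Space N → ℝ}, LocallyIntegrable h →
      AEStronglyMeasurable (contractMollify hδ h) (volume.restrict (cube N)) := fun hh =>
    (contDiff_contractMollify hδ hh).continuous.aestronglyMeasurable
  have hdecomp : contractMollify hδ f - f =
      contractMollify hδ (f - g) + ((contractMollify hδ g - g) + (g - f)) := by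
    rw [contractMollify_sub hδ hfl hgl]; abel
  rw [hdecomp]
  have hgm : AEStronglyMeasurable g (volume.restrict (cube N)) := hg.aestronglyMeasurable
  refine (eLpNorm_add_le (hc (hfl.sub hgl)) (((hc hgl).sub hgm).add
    (hgm.sub hf.1.restrict)) hp1).trans ?_
  refine (add_le_add_right (eLpNorm_add_le ((hc hgl).sub hgm)
    (hgm.sub hf.1.restrict) hp1) _).trans ?_
  have e1 : eLpNorm (contractMollify hδ (f - g)) (ENNReal.ofReal r) (volume.restrict (cube N)) ≤
      ENNReal.ofReal (ε / 3) := by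
    refine (eLpNorm_mono_measure _ Measure.restrict_le_self).trans ?_
    refine (eLpNorm_contractMollify_le hδ hδ2 (hf.1.sub hg.aestronglyMeasurable) hr).trans ?_
    calc _ ≤ 2 ^ N * ENNReal.ofReal η := by gcongr
      _ = ENNReal.ofReal (ε / 3) := by
        rw [← ENNReal.ofReal_ofNat 2, ← ENNReal.ofReal_pow (by norm_num),
          ← ENNReal.ofReal_mul (by positivity), hηdef]
        congr 1
        field_simp
  have e2 : eLpNorm (contractMollify hδ g - g) (ENNReal.ofReal r) (volume.restrict (cube N)) ≤
      ENNReal.ofReal (ε / 3) := eLpNorm_cube_le_of_bound (fun x hx => h₁ hδ x hx) _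
  have e3 : eLpNorm (g - f) (ENNReal.ofReal r) (volume.restrict (cube N)) ≤
      ENNReal.ofReal (ε / 3) := by
    refine (eLpNorm_mono_measure _ Measure.restrict_le_self).trans ?_
    rw [eLpNorm_sub_comm]
    exact hgc.trans (ENNReal.ofReal_le_ofReal hη')
  calc _ ≤ ENNReal.ofReal (ε / 3) + (ENNReal.ofReal (ε / 3) + ENNReal.ofReal (ε / 3)) := by gcongr
    _ = ENNReal.ofReal ε := by
      rw [← ENNReal.ofReal_add (by positivity) (by positivity),
        ← ENNReal.ofReal_add (by positivity) (by positivity)]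
      congr 1; ring

/-! ### Splines approximating fields of bounded deformation -/

theorem IsBD.isSymDeriv {u : Space N → Space N} (hu : IsBD u) (i j : Fin N) :
    IsSymDeriv u i j (symDeriv u i j) := by
  obtain ⟨μ, hμ⟩ := hu.2 i j
  rw [hμ.symDeriv_eq]
  exact hμ

/-- The components of a spline are the combinations of nodal hats with the given coefficients. -/
theorem spline_apply {m : ℕ} (c : (Fin N → Fin (m + 1)) → Fin N → ℝ) (x : Space N) (j : Fin N) :
    (∑ α, ∑ k, (c α k * hat ((meshSize m)⁻¹ • (x - gridNode m α))) • basisVec k : Space N) j =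
      ∑ α, c α j * nodalHat m α x := by
  rw [WithLp.ofLp_sum, Finset.sum_apply]
  refine Finset.sum_congr rfl fun α _ => ?_
  rw [WithLp.ofLp_sum, Finset.sum_apply, Finset.sum_eq_single j]
  · simp [basisVec, nodalHat]
  · intro k _ hk
    simp [basisVec, hk.symm]
  · simp

theorem exists_lipschitzWith_apply_of_mem_splineSpace {m : ℕ} (hm : 1 ≤ m)
    {v : Space N → Space N} (hv : v ∈ splineSpace N m) (k : Fin N) :
    ∃ C, LipschitzWith C fun x => v x k := by
  obtain ⟨c, hc⟩ := hv
  obtain ⟨C, hC⟩ := exists_lipschitzWith_sum_mul_nodalHat hm fun α => c α k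
  refine ⟨C, ?_⟩
  convert hC using 2 with x
  rw [hc x, spline_apply]

theorem continuous_of_mem_splineSpace {m : ℕ} (hm : 1 ≤ m)
    {v : Space N → Space N} (hv : v ∈ splineSpace N m) : Continuous v := by
  have h : Continuous fun x => WithLp.ofLp (v x) := continuous_pi fun k =>
    (exists_lipschitzWith_apply_of_mem_splineSpace hm hv k).choose_spec.continuous
  exact (PiLp.continuous_toLp 2 _).comp h

theorem isBD_of_mem_splineSpace {m : ℕ} (hm : 1 ≤ m)
    {v : Space N → Space N} (hv : v ∈ splineSpace N m) : IsBD v :=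
  isBD_of_lipschitz (continuous_of_mem_splineSpace hm hv)
    (exists_lipschitzWith_apply_of_mem_splineSpace hm hv)

theorem memLp_of_mem_splineSpace {m : ℕ} (hm : 1 ≤ m)
    {v : Space N → Space N} (hv : v ∈ splineSpace N m) (p : ℝ≥0∞) :
    MemLp v p (volume.restrict (cube N)) := by
  have hc := continuous_of_mem_splineSpace hm hv
  obtain ⟨C, hC⟩ :=
    (isBounded_cube N).isCompact_closure.exists_bound_of_continuousOn hc.continuousOn
  exact MemLp.of_bound hc.aestronglyMeasurable C
    ((ae_restrict_iff' (measurableSet_cube N)).2 (ae_of_all _ fun x hx => hC x (subset_closure hx)))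

theorem zero_mem_splineSpace (N m : ℕ) : (0 : Space N → Space N) ∈ splineSpace N m :=
  ⟨0, fun x => by simp⟩

theorem eventually_ofReal_inv_pow_mul_le (N : ℕ) {T : ℝ≥0∞} (hT : T ≠ ⊤) {ε : ℝ} (hε : 0 < ε) :
    ∀ᶠ δ in 𝓝[>] (0 : ℝ),
      ENNReal.ofReal (((1 - 2 * δ) ^ N)⁻¹) * T ≤ T + ENNReal.ofReal ε := by
  have h1 : Tendsto (fun δ : ℝ => ((1 - 2 * δ) ^ N)⁻¹ * T.toReal) (𝓝 0) (𝓝 (1 * T.toReal)) := by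
    have : ContinuousAt (fun δ : ℝ => ((1 - 2 * δ) ^ N)⁻¹ * T.toReal) 0 := by
      refine ContinuousAt.mul (ContinuousAt.inv₀ (by fun_prop) (by simp)) continuousAt_const
    simpa using this.tendsto
  have h2 := (h1.mono_left (nhdsWithin_le_nhds (s := Set.Ioi 0))).eventually_lt_const
    (show 1 * T.toReal < T.toReal + ε by linarith)
  have hmem : Set.Ioo (0 : ℝ) (1 / 4) ∈ 𝓝[>] (0 : ℝ) := Ioo_mem_nhdsGT (by norm_num)
  filter_upwards [h2, hmem] with δ hδ hδ2
  have hpos : 0 < 1 - 2 * δ := by linarith [hδ2.2]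
  rw [← ENNReal.ofReal_toReal hT, ← ENNReal.ofReal_mul (by positivity),
    ← ENNReal.ofReal_add ENNReal.toReal_nonneg hε.le]
  exact ENNReal.ofReal_le_ofReal hδ.le

/-- A field in `BD ∩ L^r` is approximated in `L^r` by compactly supported `C¹` fields on the whole
space whose symmetric derivatives have `L¹` norms on the cube that barely exceed the total
variations. -/
theorem exists_contDiff_approx {u : Space N → Space N} (hBD : IsBD u) {r : ℝ} (hr : 1 ≤ r)
    (hLr : MemLp u (ENNReal.ofReal r) (volume.restrict (cube N))) {ε : ℝ} (hε : 0 < ε) :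
    ∃ w : Fin N → Space N → ℝ, (∀ j, ContDiff ℝ 1 (w j)) ∧ (∀ j, HasCompactSupport (w j)) ∧
      (∀ j, eLpNorm (fun x => w j x - u x j) (ENNReal.ofReal r) (volume.restrict (cube N)) ≤
        ENNReal.ofReal ε) ∧
      ∀ i j, ∫⁻ x in cube N,
        ‖(1 / 2 : ℝ) * (partialDeriv i (w j) x + partialDeriv j (w i) x)‖ₑ ≤
          (symDeriv u i j).totalVariation (cube N) + ENNReal.ofReal ε := by
  have hp1 : 1 ≤ ENNReal.ofReal r := by simpa using hr
  set f : Fin N → Space N → ℝ := fun j => (cube N).indicator fun y => u y j with hf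
  have hfL : ∀ j, MemLp (f j) (ENNReal.ofReal r) volume := fun j =>
    (memLp_indicator_iff_restrict (measurableSet_cube N)).2
      ((EuclideanSpace.proj j : Space N →L[ℝ] ℝ).comp_memLp' hLr)
  have hfs : ∀ j, HasCompactSupport (f j) := fun j =>
    HasCompactSupport.of_support_subset_isCompact (isBounded_cube N).isCompact_closure
      (Set.support_indicator_subset.trans subset_closure)
  have hmem : ∀ᶠ δ in 𝓝[>] (0 : ℝ), δ ∈ Set.Ioo (0 : ℝ) (1 / 4) :=
    Ioo_mem_nhdsGT (by norm_num)
  have h1 := eventually_all.2 fun j => eventually_eLpNorm_contractMollify_sub_le hr (hfL j) hε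
  have h2 := eventually_all.2 fun i => eventually_all.2 fun j => eventually_ofReal_inv_pow_mul_le N
    (measure_ne_top (symDeriv u i j).totalVariation (cube N)) hε
  obtain ⟨δ, hδ, h1, h2⟩ := (hmem.and (h1.and h2)).exists
  refine ⟨fun j => contractMollify hδ.1 (f j),
    fun j => contDiff_contractMollify hδ.1 ((hfL j).locallyIntegrable hp1),
    fun j => hasCompactSupport_contractMollify hδ.1 hδ.2.le (hfs j), fun j => ?_, fun i j =>
    (lintegral_symPartial_contractMollify_le hδ.1 hδ.2.le hBD.1 (hBD.isSymDeriv i j)).trans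
      (h2 i j)⟩
  refine (eLpNorm_congr_ae ?_).trans_le (h1 j hδ.1)
  refine (ae_restrict_iff' (measurableSet_cube N)).2 (ae_of_all _ fun x hx => ?_)
  simp [hf, hx]

/-- Every fine grid carries a spline that is `L^r`-close to `u` and whose total variations barely
exceed those of `u`: the nodal interpolant of a `C¹` approximation. -/
theorem eventually_exists_spline_approx {u : Space N → Space N} (hBD : IsBD u) {r : ℝ} (hr : 1 ≤ r)
    (hLr : MemLp u (ENNReal.ofReal r) (volume.restrict (cube N))) {η : ℝ} (hη : 0 < η) :
    ∀ᶠ m : ℕ in atTop, ∃ v ∈ splineSpace N m,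
      eLpNorm (fun x => v x - u x) (ENNReal.ofReal r) (volume.restrict (cube N)) ≤
        ENNReal.ofReal η ∧
      ∀ i j, (symDeriv v i j).totalVariation (cube N) ≤
        (symDeriv u i j).totalVariation (cube N) + ENNReal.ofReal η := by
  have hp1 : 1 ≤ ENNReal.ofReal r := by simpa using hr
  -- Two errors of size `ε` in each of the `N` components.
  set ε : ℝ := η / (2 * (N + 1)) with hεdef
  have hε : 0 < ε := by positivity
  have hNε : N * (ε + ε) ≤ η := by
    rw [hεdef]
    calc N * (η / (2 * (N + 1)) + η / (2 * (N + 1))) = η * (N / (N + 1)) := by field_simp; norm_num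
      _ ≤ η * 1 := by
        gcongr
        rw [div_le_one (by positivity)]; linarith
      _ = η := mul_one η
  have h2ε : ε + ε ≤ η := by
    have : ε + ε = η / (N + 1) := by rw [hεdef]; field_simp; norm_num
    rw [this]
    exact div_le_self hη.le (by linarith [Nat.cast_nonneg (α := ℝ) N])
  obtain ⟨w, hw, hws, hwu, hwE⟩ := exists_contDiff_approx hBD hr hLr hε
  filter_upwards [eventually_ge_atTop 1,
    eventually_all.2 fun j => eventually_nodalInterp_close (hw j) (hws j) hε] with m hm hclose
  set c : (Fin N → Fin (m + 1)) → Fin N → ℝ := fun α k => w k (gridNode m α) with hc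
  set v : Space N → Space N := fun x =>
    ∑ α, ∑ k, (c α k * hat ((meshSize m)⁻¹ • (x - gridNode m α))) • basisVec k with hv
  have hvS : v ∈ splineSpace N m := ⟨c, fun x => rfl⟩
  have hvj : ∀ j, (fun x => v x j) = nodalInterp m (w j) := fun j => by
    ext x; exact spline_apply c x j
  have hLip := exists_lipschitzWith_apply_of_mem_splineSpace hm hvS
  refine ⟨v, hvS, ?_, fun i j => ?_⟩
  · have hwm : ∀ j, AEStronglyMeasurable (w j) (volume.restrict (cube N)) := fun j =>
      (hw j).continuous.aestronglyMeasurable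
    have hvm : ∀ j, AEStronglyMeasurable (fun x => v x j) (volume.restrict (cube N)) := fun j =>
      (hLip j).choose_spec.continuous.aestronglyMeasurable
    have hum : ∀ j, AEStronglyMeasurable (fun x => u x j) (volume.restrict (cube N)) := fun j =>
      ((EuclideanSpace.proj j : Space N →L[ℝ] ℝ).comp_memLp' hLr).1
    have hcomp : ∀ j, eLpNorm (fun x => v x j - u x j) (ENNReal.ofReal r)
        (volume.restrict (cube N)) ≤ ENNReal.ofReal (ε + ε) := by
      intro j
      have hsplit : (fun x => v x j - u x j) =
          (fun x => v x j - w j x) + fun x => w j x - u x j := by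
        ext x; simp
      rw [hsplit, ENNReal.ofReal_add hε.le hε.le]
      refine (eLpNorm_add_le ((hvm j).sub (hwm j)) ((hwm j).sub (hum j)) hp1).trans
        (add_le_add (eLpNorm_cube_le_of_bound (fun x hx => ?_) _) (hwu j))
      have := (hclose j x hx).1
      rwa [← hvj j] at this
    calc eLpNorm (fun x => v x - u x) (ENNReal.ofReal r) (volume.restrict (cube N))
        ≤ eLpNorm (fun x => ∑ j, |v x j - u x j|) (ENNReal.ofReal r)
            (volume.restrict (cube N)) :=
          eLpNorm_mono_real fun x => norm_le_sum_abs (v x - u x)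
      _ ≤ ∑ j, eLpNorm (fun x => |v x j - u x j|) (ENNReal.ofReal r)
            (volume.restrict (cube N)) := by
          have := eLpNorm_sum_le (p := ENNReal.ofReal r) (μ := volume.restrict (cube N))
            (s := Finset.univ) (f := fun j x => |v x j - u x j|)
            (fun j _ => ((hvm j).sub (hum j)).norm) hp1
          refine le_trans (le_of_eq ?_) this
          congr 1 with x
          rw [Finset.sum_apply]
      _ ≤ ∑ _j : Fin N, ENNReal.ofReal (ε + ε) := Finset.sum_le_sum fun j _ => by
          refine le_trans (le_of_eq ?_) (hcomp j)
          exact eLpNorm_norm fun x => v x j - u x j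
      _ ≤ ENNReal.ofReal η := by
          rw [Finset.sum_const, Finset.card_univ, Fintype.card_fin, nsmul_eq_mul,
            ← ENNReal.ofReal_natCast, ← ENNReal.ofReal_mul (by positivity)]
          exact ENNReal.ofReal_le_ofReal hNε
  · rw [totalVariation_symDeriv_of_lipschitz hLip i j]
    have hd : ∀ k l : Fin N, ∀ᵐ x ∂volume.restrict (cube N),
        |lineDeriv ℝ (fun y => v y k) x (basisVec l) - partialDeriv l (w k) x| ≤ ε := by
      intro k l
      obtain ⟨C, hC⟩ := hLip k
      filter_upwards [ae_restrict_mem (measurableSet_cube N),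
        ae_restrict_of_ae (hC.ae_lineDifferentiableAt (μ := volume) (basisVec l))] with x hx hx'
      rw [hvj k] at hx' ⊢
      exact (hclose k x hx).2 l hx'
    have hle : ∀ᵐ x ∂volume.restrict (cube N), ‖symDensity v i j x‖ₑ ≤
        ‖(1 / 2 : ℝ) * (partialDeriv i (w j) x + partialDeriv j (w i) x)‖ₑ +
          ENNReal.ofReal ε := by
      filter_upwards [hd j i, hd i j] with x h1 h2
      have h3 : symDensity v i j x =
          (1 / 2 : ℝ) * (partialDeriv i (w j) x + partialDeriv j (w i) x) +
          (symDensity v i j x -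
            (1 / 2 : ℝ) * (partialDeriv i (w j) x + partialDeriv j (w i) x)) := by ring
      rw [h3]
      refine (enorm_add_le _ _).trans (add_le_add_right ?_ _)
      rw [← ofReal_norm, Real.norm_eq_abs, symDensity]
      apply ENNReal.ofReal_le_ofReal
      rw [abs_le] at h1 h2 ⊢
      constructor <;> linarith [h1.1, h1.2, h2.1, h2.2]
    refine (lintegral_mono_ae hle).trans ?_
    rw [lintegral_add_right _ measurable_const, lintegral_const, measure_univ, mul_one]
    calc _ ≤ (symDeriv u i j).totalVariation (cube N) + ENNReal.ofReal ε + ENNReal.ofReal ε := by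
          gcongr; exact hwE i j
      _ ≤ _ := by
          rw [add_assoc, ← ENNReal.ofReal_add hε.le hε.le]
          gcongr

/-- A diagonal argument: near-minimisers of `e` over the sets `S n` make `e` tend to `0`. -/
theorem exists_seq_tendsto_zero_of_eventually_exists_le {X : Type*} {S : ℕ → Set X}
    (hS : ∀ n, (S n).Nonempty) {e : X → ℝ≥0∞}
    (h : ∀ η : ℝ, 0 < η → ∀ᶠ n in atTop, ∃ v ∈ S n, e v ≤ ENNReal.ofReal η) :
    ∃ v : ℕ → X, (∀ n, v n ∈ S n) ∧ Tendsto (fun n => e (v n)) atTop (𝓝 0) := by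
  have hex : ∀ n, ∃ v ∈ S n, e v ≤ (⨅ v ∈ S n, e v) + ((n : ℝ≥0∞))⁻¹ := by
    intro n
    by_cases htop : (⨅ v ∈ S n, e v) = ⊤
    · obtain ⟨v, hv⟩ := hS n
      exact ⟨v, hv, by rw [htop, top_add]; exact le_top⟩
    · have hlt := ENNReal.lt_add_right htop
        (ENNReal.inv_ne_zero.2 (ENNReal.natCast_ne_top n))
      simp only [iInf_lt_iff, exists_prop] at hlt
      obtain ⟨v, hv, hve⟩ := hlt
      exact ⟨v, hv, hve.le⟩
  choose v hvS hve using hex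
  refine ⟨v, hvS, ?_⟩
  have hinf : Tendsto (fun n => ⨅ v ∈ S n, e v) atTop (𝓝 0) := by
    refine ENNReal.tendsto_nhds_zero.2 fun ε hε => ?_
    obtain ⟨η, hη0, hη1, hη2⟩ := ENNReal.lt_iff_exists_real_btwn.1 hε
    have hη : 0 < η := by simpa using hη1
    filter_upwards [h η hη] with n ⟨w, hwS, hwe⟩
    exact (iInf₂_le w hwS).trans (hwe.trans hη2.le)
  have hsum := hinf.add ENNReal.tendsto_inv_nat_nhds_zero
  rw [add_zero] at hsum
  exact tendsto_of_tendsto_of_tendsto_of_le_of_le tendsto_const_nhds hsum (fun _ => zero_le) hve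

theorem tendsto_integral_rpow_of_eLpNorm {r : ℝ} (hr : 1 ≤ r) {u : Space N → Space N}
    {v : ℕ → Space N → Space N}
    (hu : MemLp u (ENNReal.ofReal r) (volume.restrict (cube N)))
    (hv : ∀ n, MemLp (v n) (ENNReal.ofReal r) (volume.restrict (cube N)))
    (h : Tendsto (fun n => eLpNorm (fun x => v n x - u x) (ENNReal.ofReal r)
      (volume.restrict (cube N))) atTop (𝓝 0)) :
    Tendsto (fun n => ∫ x in cube N, ‖v n x - u x‖ ^ r) atTop (𝓝 0) := by
  have hr0 : 0 < r := by linarith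
  have h1 : ∀ n, ∫ x in cube N, ‖v n x - u x‖ ^ r =
      (eLpNorm (fun x => v n x - u x) (ENNReal.ofReal r)
        (volume.restrict (cube N))).toReal ^ r := by
    intro n
    have hnn : 0 ≤ ∫ x in cube N, ‖v n x - u x‖ ^ r :=
      integral_nonneg fun x => by positivity
    have hLp : MemLp (fun x => v n x - u x) (ENNReal.ofReal r) (volume.restrict (cube N)) :=
      (hv n).sub hu
    rw [hLp.eLpNorm_eq_integral_rpow_norm (by simpa using hr0) ENNReal.ofReal_ne_top,
      ENNReal.toReal_ofReal hr0.le, ENNReal.toReal_ofReal (Real.rpow_nonneg hnn _)]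
    exact (Real.rpow_inv_rpow hnn hr0.ne').symm
  simp_rw [h1]
  have h2 := ((ENNReal.tendsto_toReal ENNReal.zero_ne_top).comp h).rpow_const
    (p := r) (Or.inr hr0.le)
  simpa [Real.zero_rpow hr0.ne'] using h2

theorem tendsto_integral_norm_of_eLpNorm {r : ℝ} (hr : 1 ≤ r) {u : Space N → Space N}
    {v : ℕ → Space N → Space N}
    (hu : MemLp u (ENNReal.ofReal r) (volume.restrict (cube N)))
    (hv : ∀ n, MemLp (v n) (ENNReal.ofReal r) (volume.restrict (cube N)))
    (h : Tendsto (fun n => eLpNorm (fun x => v n x - u x) (ENNReal.ofReal r)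
      (volume.restrict (cube N))) atTop (𝓝 0)) :
    Tendsto (fun n => ∫ x in cube N, ‖v n x - u x‖) atTop (𝓝 0) := by
  have hp1 : ENNReal.ofReal 1 ≤ ENNReal.ofReal r := ENNReal.ofReal_le_ofReal hr
  have h1 : Tendsto (fun n => eLpNorm (fun x => v n x - u x) (ENNReal.ofReal 1)
      (volume.restrict (cube N))) atTop (𝓝 0) :=
    tendsto_of_tendsto_of_tendsto_of_le_of_le tendsto_const_nhds h (fun _ => zero_le)
      fun n => eLpNorm_le_eLpNorm_of_exponent_le hp1 ((hv n).sub hu).1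
  simpa using tendsto_integral_rpow_of_eLpNorm le_rfl (hu.mono_exponent hp1)
    (fun n => (hv n).mono_exponent hp1) h1

end BDSpline

theorem mainTheorem4 (N : ℕ) (m : ℕ → ℕ) (hm : ∀ n, 1 ≤ m n)
    (hh : Tendsto (fun n => meshSize (m n)) atTop (𝓝 0))
    (r : ℝ) (hr : 1 ≤ r) (u : Space N → Space N) (hBD : IsBD u)
    (hLr : MemLp u (ENNReal.ofReal r) (volume.restrict (cube N))) :
    ∃ v : ℕ → Space N → Space N,
      (∀ n, v n ∈ splineSpace N (m n)) ∧
      (∀ n, IsBD (v n)) ∧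
      (∀ n, MemLp (v n) (ENNReal.ofReal r) (volume.restrict (cube N))) ∧
      Tendsto (fun n => ∫ x in cube N, ‖u x - v n x‖ ^ r) atTop (𝓝 0) ∧
      Tendsto (fun n => totalDeformation (v n)) atTop (𝓝 (totalDeformation u)) ∧
      Tendsto (fun n => strictDist (v n) u) atTop (𝓝 0) := by
  have hmtop : Tendsto m atTop atTop := by
    have h1 : Tendsto (fun n => meshSize (m n)) atTop (𝓝[>] 0) :=
      tendsto_nhdsWithin_iff.2 ⟨hh, Eventually.of_forall fun n => by
        have : (0 : ℝ) < m n := by exact_mod_cast hm n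
        simpa [meshSize] using this⟩
    have h2 := tendsto_inv_nhdsGT_zero.comp h1
    simpa [Function.comp_def, meshSize, tendsto_natCast_atTop_iff] using h2
  -- The truncated subtraction in `e` measures only the excess of the total variations over those
  -- of `u`; a deficit is excluded by lower semicontinuity.
  set e : (Space N → Space N) → ENNReal := fun v =>
    max (eLpNorm (fun x => v x - u x) (ENNReal.ofReal r) (volume.restrict (cube N)))
      (⨆ i, ⨆ j, (symDeriv v i j).totalVariation (cube N) -
        (symDeriv u i j).totalVariation (cube N)) with he
  obtain ⟨v, hvS, hve⟩ := exists_seq_tendsto_zero_of_eventually_exists_le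
    (S := fun n => splineSpace N (m n)) (fun n => ⟨0, zero_mem_splineSpace N (m n)⟩) (e := e)
    fun η hη => (hmtop.eventually (eventually_exists_spline_approx hBD hr hLr hη)).mono
      fun n ⟨v, hvS, hv1, hv2⟩ => ⟨v, hvS, max_le hv1 (iSup₂_le fun i j =>
        tsub_le_iff_left.2 (hv2 i j))⟩
  have hvBD : ∀ n, IsBD (v n) := fun n => isBD_of_mem_splineSpace (hm n) (hvS n)
  have hvL : ∀ n, MemLp (v n) (ENNReal.ofReal r) (volume.restrict (cube N)) := fun n =>
    memLp_of_mem_splineSpace (hm n) (hvS n) _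
  have hLp : Tendsto (fun n => eLpNorm (fun x => v n x - u x) (ENNReal.ofReal r)
      (volume.restrict (cube N))) atTop (𝓝 0) :=
    tendsto_of_tendsto_of_tendsto_of_le_of_le tendsto_const_nhds hve (fun _ => zero_le)
      fun n => le_max_left _ _
  have hL1 := tendsto_integral_norm_of_eLpNorm hr hLr hvL hLp
  have hTV : ∀ i j, Tendsto (fun n => ((symDeriv (v n) i j).totalVariation (cube N)).toReal) atTop
      (𝓝 ((symDeriv u i j).totalVariation (cube N)).toReal) := by
    intro i j
    refine Metric.tendsto_nhds.2 fun η hη => ?_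
    have hlow := (hBD.isSymDeriv i j).eventually_totalVariation_le
      (fun n => (hvBD n).isSymDeriv i j) hBD.1 (fun n => (hvBD n).1) hL1 (half_pos hη)
    have hup := ENNReal.tendsto_nhds_zero.1 hve (ENNReal.ofReal (η / 2)) (by simpa using hη)
    filter_upwards [hlow, hup] with n h1 h2
    have h3 : (symDeriv (v n) i j).totalVariation (cube N) ≤
        (symDeriv u i j).totalVariation (cube N) + ENNReal.ofReal (η / 2) :=
      tsub_le_iff_left.1 ((le_iSup₂ (f := fun i j => (symDeriv (v n) i j).totalVariation (cube N) -
        (symDeriv u i j).totalVariation (cube N)) i j).trans ((le_max_right _ _).trans h2))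
    have h4 := ENNReal.toReal_mono (by finiteness) h3
    rw [ENNReal.toReal_add (by finiteness) (by finiteness),
      ENNReal.toReal_ofReal (by positivity)] at h4
    rw [Real.dist_eq, abs_lt]
    constructor <;> linarith
  have hTD : Tendsto (fun n => totalDeformation (v n)) atTop (𝓝 (totalDeformation u)) :=
    tendsto_finsetSum _ fun i _ => tendsto_finsetSum _ fun j _ => hTV i j
  refine ⟨v, hvS, hvBD, hvL, ?_, hTD, ?_⟩
  · simpa only [norm_sub_rev] using tendsto_integral_rpow_of_eLpNorm hr hLr hvL hLp
  · have h := hL1.add (hTD.sub_const (totalDeformation u)).abs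
    simpa [strictDist] using h
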